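/- **Theorem 1.10.** Let $m\ge 1$, let $0=k_0<k_1<\dots<k_m<k_{m+1}=d$ be integers, and let $$A=\begin{pmatrix}1&1&\cdots&1&1\\ 0&k_1&\cdots&k_m&d\end{pmatrix},\qquad x=(x_0,x_{k_1},\dots,x_{k_m},x_d),\qquad f(x;t)=x_0+x_{k_1}t^{k_1}+\dots+x_{k_m}t^{k_m}+x_dt^d .$$ For $\alpha=(\alpha_1,\alpha_2)\in\mathbb C^2$, a *rational solution* of the $A$-hypergeometric system with exponent $\alpha$ is a rational function $\varphi\in\mathbb C(x)$ with $$\Bigl(\prod_{v_j>0}\partial_j^{\,v_j}-\prod_{v_j<0}\partial_j^{\,-v_j}\Bigr)\varphi=0\quad\text{for all } v\in\mathbb Z^{m+2}\text{ with }Av=0,\qquad \sum_j A_{ij}\,x_j\,\partial_j\varphi=\alpha_i\varphi\quad(i=1,2).$$ For an integer matrix $M$ with $q$ columns and first row $(1,\dots,1)$, and an integer vector $\beta$, put $\Phi^M(\beta;y)=\sum_{u\in\mathbb N^q,\ Mu=\beta}y^u/u!$. Let $B$, respectively $C$, be $A$ without its last, respectively first, column, let $x'$, respectively $\tilde x$,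 be $x$ without $x_d$, respectively $x_0$, and for $\alpha\in\mathbb Z^2$ put $$\Psi^A_d(\alpha;x)=\sum_{r\ge1}(-1)^r(r-1)!\,\frac{\Phi^B(\alpha+r(1,d);x')}{x_d^{\,r}},\qquad \Psi^A_0(\alpha;x)=\sum_{r\ge1}(-1)^r(r-1)!\,\frac{\Phi^C(\alpha+r(1,0);\tilde x)}{x_0^{\,r}}$$ (all these sums are finite). Then: 1. For every $\alpha\in\mathbb C^2$, every rational solution with exponent $\alpha$ is a Laurent polynomial. Its reduced denominator divides a monomial $x_0^ax_d^b$; in particular no irreducible factor of the discriminant of $f(x;t)$ with respect to $t$, other than $x_0$ and $x_d$ (up to constants), divides that denominator. 2. If $\alpha\in\mathbb C^2\setminus\mathbb Z^2$, the only rational solution with exponent $\alpha$ is $0$. 3. If $\alpha\in A\cdot\mathbb N^{m+2}$, the rational solutions with exponent $\alpha$ are exactly the functions $c\,\Phi^A(\alpha;x)$ with $c\in\mathbb C$. 4. If $\alpha\in\mathbb Z^2\setminus A\cdot\mathbb N^{m+2}$, the rational solutions with exponent $\alpha$ are exactly the functions $c_0\,\Psi^A_0(\alpha;x)+c_d\,\Psi^A_d(\alpha;x)$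 with $c_0,c_d\in\mathbb C$. -/

import Mathlib

noncomputable section

namespace GKZ

/-- The field `ℂ(x₁, …, x_r)` of rational functions in `r` variables. -/
abbrev RatFun (r : ℕ) : Type := FractionRing (MvPolynomial (Fin r) ℂ)

/-- The inclusion of polynomials into rational functions. -/
abbrev ofPoly {r : ℕ} (P : MvPolynomial (Fin r) ℂ) : RatFun r :=
  algebraMap (MvPolynomial (Fin r) ℂ) (RatFun r) P

/-- The variable `x_j` as a rational function. -/
abbrev var {r : ℕ} (j : Fin r) : RatFun r := ofPoly (MvPolynomial.X j)

section FractionField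

variable {F R K : Type*} [Field F] [CommRing R] [IsDomain R] [UniqueFactorizationMonoid R]
  [Algebra F R] [Field K] [Algebra R K] [IsFractionRing R K]

/-- The derivative of the reduced fraction `P / Q` by the quotient rule, for a derivation `D`
of `R` and `P, Q ∈ R`. -/
def quotDeriv (D : Derivation F R R) (y : K) : K :=
  (algebraMap R K (D (IsFractionRing.num R y)) * algebraMap R K (IsFractionRing.den R y) -
    algebraMap R K (IsFractionRing.num R y) * algebraMap R K (D (IsFractionRing.den R y))) /
      algebraMap R K (IsFractionRing.den R y) ^ 2

/-- The quotient rule holds for every representation as a fraction, reduced or not. -/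
theorem quotDeriv_div (D : Derivation F R R) (P Q : R) (hQ : Q ≠ 0) :
    quotDeriv D (algebraMap R K P / algebraMap R K Q) =
      (algebraMap R K (D P) * algebraMap R K Q - algebraMap R K P * algebraMap R K (D Q)) /
        algebraMap R K Q ^ 2 := by
  have inj := IsFractionRing.injective R K
  have h1 := IsFractionRing.mk'_num_den' R (algebraMap R K P / algebraMap R K Q)
  unfold quotDeriv
  generalize IsFractionRing.num R (algebraMap R K P / algebraMap R K Q) = P' at *
  generalize IsFractionRing.den R (algebraMap R K P / algebraMap R K Q) = Q₀ at *
  obtain ⟨Q', hQ'⟩ := Q₀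
  replace hQ' : Q' ≠ 0 := nonZeroDivisors.ne_zero hQ'
  have hQK : algebraMap R K Q ≠ 0 := (map_ne_zero_iff _ inj).2 hQ
  have hQK' : algebraMap R K Q' ≠ 0 := (map_ne_zero_iff _ inj).2 hQ'
  simp only at *
  rw [div_eq_div_iff hQK' hQK, ← map_mul, ← map_mul] at h1
  have h2 := congrArg (algebraMap R K) (congrArg D (inj h1))
  replace h1 := congrArg (algebraMap R K) (inj h1)
  simp only [Derivation.leibniz, smul_eq_mul, map_add, map_mul] at h1 h2
  rw [div_eq_div_iff (pow_ne_zero 2 hQK') (pow_ne_zero 2 hQK)]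
  linear_combination algebraMap R K Q * algebraMap R K Q' * h2 -
    (algebraMap R K Q * algebraMap R K (D Q') + algebraMap R K Q' * algebraMap R K (D Q)) * h1

variable [Algebra F K] [IsScalarTower F R K]

/-- The extension of a derivation of `R` to the fraction field. -/
def fracDeriv (D : Derivation F R R) : Derivation F K K :=
  Derivation.mk'
    { toFun := quotDeriv D
      map_add' := fun y z => by
        obtain ⟨P, Q, hQ, rfl⟩ := IsFractionRing.div_surjective R y
        obtain ⟨S, T, hT, rfl⟩ := IsFractionRing.div_surjective R z
        replace hQ := nonZeroDivisors.ne_zero hQ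
        replace hT := nonZeroDivisors.ne_zero hT
        have hQK : algebraMap R K Q ≠ 0 := (map_ne_zero_iff _ (IsFractionRing.injective R K)).2 hQ
        have hTK : algebraMap R K T ≠ 0 := (map_ne_zero_iff _ (IsFractionRing.injective R K)).2 hT
        rw [div_add_div _ _ hQK hTK, ← map_mul, ← map_mul, ← map_mul, ← map_add,
          quotDeriv_div D _ _ (mul_ne_zero hQ hT), quotDeriv_div D _ _ hQ, quotDeriv_div D _ _ hT]
        simp only [Derivation.leibniz, smul_eq_mul, map_add, map_mul]
        field_simp
        ring
      map_smul' := fun c y => by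
        obtain ⟨P, Q, hQ, rfl⟩ := IsFractionRing.div_surjective R y
        replace hQ := nonZeroDivisors.ne_zero hQ
        have e : c • (algebraMap R K P / algebraMap R K Q)
            = algebraMap R K (c • P) / algebraMap R K Q := by
          rw [Algebra.smul_def, Algebra.smul_def, map_mul, mul_div_assoc,
            ← IsScalarTower.algebraMap_apply]
        rw [e, quotDeriv_div D _ _ hQ, quotDeriv_div D _ _ hQ, Derivation.map_smul]
        simp only [Algebra.smul_def, map_mul, ← IsScalarTower.algebraMap_apply, RingHom.id_apply]
        ring }
    (fun y z => by
      obtain ⟨P, Q, hQ, rfl⟩ := IsFractionRing.div_surjective R y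
      obtain ⟨S, T, hT, rfl⟩ := IsFractionRing.div_surjective R z
      replace hQ := nonZeroDivisors.ne_zero hQ
      replace hT := nonZeroDivisors.ne_zero hT
      have hQK : algebraMap R K Q ≠ 0 := (map_ne_zero_iff _ (IsFractionRing.injective R K)).2 hQ
      have hTK : algebraMap R K T ≠ 0 := (map_ne_zero_iff _ (IsFractionRing.injective R K)).2 hT
      simp only [LinearMap.coe_mk, AddHom.coe_mk]
      rw [div_mul_div_comm, ← map_mul, ← map_mul,
        quotDeriv_div D _ _ (mul_ne_zero hQ hT), quotDeriv_div D _ _ hQ, quotDeriv_div D _ _ hT]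
      simp only [Derivation.leibniz, smul_eq_mul, map_add, map_mul]
      field_simp
      ring)

/-- The quotient rule for the extended derivation. -/
theorem fracDeriv_div (D : Derivation F R R) (P Q : R) (hQ : Q ≠ 0) :
    fracDeriv D (algebraMap R K P / algebraMap R K Q) =
      (algebraMap R K (D P) * algebraMap R K Q - algebraMap R K P * algebraMap R K (D Q)) /
        algebraMap R K Q ^ 2 :=
  quotDeriv_div D P Q hQ

end FractionField

/-- The derivation `∂/∂x_j` of the field of rational functions. -/
def partialD {r : ℕ} (j : Fin r) : Derivation ℂ (RatFun r) (RatFun r) :=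
  fracDeriv (MvPolynomial.pderiv j)

/-- The operator `∏_j (∂/∂x_j)^{u_j}`, where `u ∈ ℕ^r`. -/
def iterD {r : ℕ} (u : Fin r → ℕ) : Module.End ℂ (RatFun r) :=
  (List.ofFn fun j => (partialD j : RatFun r →ₗ[ℂ] RatFun r) ^ u j).prod

/-- The toric operator `𝒟_v = ∏_{v_j > 0} (∂/∂x_j)^{v_j} - ∏_{v_j < 0} (∂/∂x_j)^{-v_j}`. -/
def toricOp {r : ℕ} (v : Fin r → ℤ) : Module.End ℂ (RatFun r) :=
  iterD (fun j => (v j).toNat) - iterD (fun j => (-v j).toNat)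

/-- `φ` is a rational solution of the `A`-hypergeometric system with exponent `α`. -/
structure IsRationalSolution {n r : ℕ} (A : Matrix (Fin n) (Fin r) ℤ) (α : Fin n → ℂ)
    (φ : RatFun r) : Prop where
  toric : ∀ v : Fin r → ℤ, A.mulVec v = 0 → toricOp v φ = 0
  euler : ∀ i : Fin n, ∑ j : Fin r, A i j • (var j * partialD j φ) = α i • φ

/-- Laurent polynomials: the linear combinations of the Laurent monomials `∏_j x_j^{n_j}`
with `n ∈ ℤ^r`. -/
def laurentPolynomials (r : ℕ) : Submodule ℂ (RatFun r) :=
  Submodule.span ℂ (Set.range fun n : Fin r → ℤ => ∏ j, var j ^ n j)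

/-- The semigroup `A · ℕ^r`. -/
def expSemigroup {n r : ℕ} (A : Matrix (Fin n) (Fin r) ℤ) : Set (Fin n → ℤ) :=
  {α | ∃ u : Fin r → ℕ, A.mulVec (fun j => (u j : ℤ)) = α}

/-- The hypergeometric polynomial `Φ^A(α; x) = ∑_{u ∈ ℕ^r, A·u = α} x^u / u!`. -/
def hypPoly {n r : ℕ} (A : Matrix (Fin n) (Fin r) ℤ) (α : Fin n → ℤ) : MvPolynomial (Fin r) ℂ :=
  ∑ᶠ (u : Fin r →₀ ℕ) (_ : A.mulVec (fun j => (u j : ℤ)) = α),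
    MvPolynomial.monomial u ((∏ j, ((u j).factorial : ℂ))⁻¹)

/-- `Ψ^A_d(α; x) = ∑_{s ≥ 1} (-1)^s (s-1)! Φ^B(α + s a_d; x') / x_d^s`, where `a_d` is the last
column of `A`, the matrix `B` is `A` without its last column, and `x'` is `x` without its last
variable `x_d`. -/
def psiLast {n r : ℕ} (A : Matrix (Fin n) (Fin (r + 1)) ℤ) (α : Fin n → ℤ) : RatFun (r + 1) :=
  ∑ᶠ (s : ℕ) (_ : 1 ≤ s), ((-1) ^ s * ((s - 1).factorial : ℂ)) •
    (ofPoly (MvPolynomial.rename Fin.castSucc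
      (hypPoly (A.submatrix id Fin.castSucc) (α + (s : ℤ) • fun i => A i (Fin.last r))))
      / var (Fin.last r) ^ s)

/-- `Ψ^A_0(α; x) = ∑_{s ≥ 1} (-1)^s (s-1)! Φ^C(α + s a_0; x̃) / x_0^s`, where `a_0` is the first
column of `A`, the matrix `C` is `A` without its first column, and `x̃` is `x` without its first
variable `x_0`. -/
def psiZero {n r : ℕ} (A : Matrix (Fin n) (Fin (r + 1)) ℤ) (α : Fin n → ℤ) : RatFun (r + 1) :=
  ∑ᶠ (s : ℕ) (_ : 1 ≤ s), ((-1) ^ s * ((s - 1).factorial : ℂ)) •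
    (ofPoly (MvPolynomial.rename Fin.succ
      (hypPoly (A.submatrix id Fin.succ) (α + (s : ℤ) • fun i => A i 0)))
      / var (0 : Fin (r + 1)) ^ s)

/-- The `2 × r` matrix with first row `(1, …, 1)` and second row `(k_1, …, k_r)`. -/
def curveMatrix {r : ℕ} (k : Fin r → ℕ) : Matrix (Fin 2) (Fin r) ℤ :=
  Matrix.of ![fun _ => 1, fun j => (k j : ℤ)]

/-- The generic polynomial `f(x; t) = ∑_j x_j t^{k_j}`, a polynomial in `t` over `ℂ[x]`. -/
def genericPoly {r : ℕ} (k : Fin r → ℕ) : Polynomial (MvPolynomial (Fin r) ℂ) :=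
  ∑ j, Polynomial.monomial (k j) (MvPolynomial.X j)

/-- For `curveMatrix` the sum defining `hypPoly` is finite. -/
theorem hypPoly_finite {r : ℕ} (k : Fin r → ℕ) (α : Fin 2 → ℤ) :
    {u : Fin r →₀ ℕ | (curveMatrix k).mulVec (fun j => (u j : ℤ)) = α}.Finite := by
  refine (Finset.finite_toSet ((Finset.univ : Finset (Fin r)).finsuppAntidiag
    (α 0).toNat)).subset ?_
  intro u hu
  have h := congrFun hu 0
  simp only [curveMatrix, Matrix.mulVec, dotProduct, Matrix.of_apply, Matrix.cons_val_zero,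
    one_mul] at h
  rw [Finset.mem_coe, Finset.mem_finsuppAntidiag]
  refine ⟨?_, Finset.subset_univ _⟩
  rw [← h, ← Nat.cast_sum, Int.toNat_natCast]

/-- `Φ^A(α; x) ≠ 0` only if `α ∈ A · ℕ^r`. -/
theorem mem_of_hypPoly_ne_zero {n r : ℕ} {A : Matrix (Fin n) (Fin r) ℤ} {α : Fin n → ℤ}
    (h : hypPoly A α ≠ 0) : α ∈ expSemigroup A := by
  by_contra hα
  refine h (finsum_eq_zero_of_forall_eq_zero fun u => ?_)
  have : ¬ A.mulVec (fun j => (u j : ℤ)) = α := fun e => hα ⟨u, e⟩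
  simp [this]

/-- The sum defining `psiLast` is finite. -/
theorem psiLast_finite {r : ℕ} (k : Fin (r + 1) → ℕ) (hk : StrictMono k) (α : Fin 2 → ℤ) :
    {s : ℕ | hypPoly ((curveMatrix k).submatrix id Fin.castSucc)
      (α + (s : ℤ) • fun i => curveMatrix k i (Fin.last r)) ≠ 0}.Finite := by
  refine (Set.finite_Iic ((k (Fin.last r) : ℤ) * α 0 - α 1 - α 0).toNat).subset ?_
  intro s hs
  obtain ⟨u, hu⟩ := mem_of_hypPoly_ne_zero hs
  have h0 := congrFun hu 0
  have h1 := congrFun hu 1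
  simp only [curveMatrix, Matrix.mulVec, dotProduct, Matrix.of_apply, Matrix.cons_val_zero,
    Matrix.submatrix_apply, id, Matrix.cons_val_one, Pi.add_apply, Pi.smul_apply, smul_eq_mul,
    one_mul, mul_one] at h0 h1
  have h2 : ∑ j : Fin r, ((k j.castSucc : ℤ) + 1) * (u j : ℤ)
      ≤ ∑ j : Fin r, (k (Fin.last r) : ℤ) * (u j : ℤ) := by
    refine Finset.sum_le_sum fun j _ => mul_le_mul_of_nonneg_right ?_ (by positivity)
    have := hk (Fin.castSucc_lt_last j)
    omega
  rw [← Finset.mul_sum] at h2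
  simp only [add_mul, Finset.sum_add_distrib, one_mul] at h2
  rw [h0, h1, mul_add] at h2
  rw [Set.mem_Iic]
  have h3 : (k (Fin.last r) : ℤ) * s = s * k (Fin.last r) := mul_comm _ _
  omega

/-- The sum defining `psiZero` is finite. -/
theorem psiZero_finite {r : ℕ} (k : Fin (r + 1) → ℕ) (hk : StrictMono k) (h0 : k 0 = 0)
    (α : Fin 2 → ℤ) :
    {s : ℕ | hypPoly ((curveMatrix k).submatrix id Fin.succ)
      (α + (s : ℤ) • fun i => curveMatrix k i 0) ≠ 0}.Finite := by
  refine (Set.finite_Iic (α 1 - α 0).toNat).subset ?_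
  intro s hs
  obtain ⟨u, hu⟩ := mem_of_hypPoly_ne_zero hs
  have h1 := congrFun hu 0
  have h2 := congrFun hu 1
  simp only [curveMatrix, Matrix.mulVec, dotProduct, Matrix.of_apply, Matrix.cons_val_zero,
    Matrix.submatrix_apply, id, Matrix.cons_val_one, Pi.add_apply, Pi.smul_apply, smul_eq_mul,
    one_mul, mul_one, h0, Nat.cast_zero, mul_zero, add_zero] at h1 h2
  have h3 : ∑ j : Fin r, (u j : ℤ) ≤ ∑ j : Fin r, (k j.succ : ℤ) * (u j : ℤ) := by
    refine Finset.sum_le_sum fun j _ => le_mul_of_one_le_left (by positivity) ?_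
    have := hk (Fin.succ_pos j)
    omega
  rw [h1, h2] at h3
  rw [Set.mem_Iic]
  omega

end GKZ

end

/-!
Expand a rational function as a Hahn series whose exponents are ordered lexicographically, and
divide the coefficient of `x^u` by `γ(u) = ∏ γ(u_j)`, where `γ` extends `n ↦ 1 / n!` to the
integers. Then `∂_j` shifts the coefficients, so the `A`-hypergeometric system says that they are
supported on `A u = α`, depend only on the negative support `{j | u_j < 0}` of `u`, and vanish
unless this negative support is minimal. A rational solution is thus a combination of the canonical
series `∑ γ(u) x^u`, one for each minimal negative support.

For a monomial curve, a negative exponent at a middle variable is impossible: together with `u` the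
support would contain an infinite descending sequence along a relation between the columns of `A`.
If the negative support consists of both ends, the coefficients `γ(u) = ± ∏ (-u_j - 1)! / ∏ u_j!`
have denominators divisible by arbitrarily large primes, whereas the expansion of a rational
function with rational coefficients has its coefficients in a finitely generated subring of `ℚ`
(as in Eisenstein's theorem on algebraic functions). The remaining negative supports `∅`, `{x_0}`
and `{x_d}` give `Φ`, `Ψ_0` and `Ψ_d`.
-/

noncomputable section

namespace GKZ

variable {n r : ℕ}

/-! ### Expansion of rational functions as Hahn series -/

section Derivations

variable {Γ R : Type*} [PartialOrder Γ] [CommRing R]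

/-- The linear map `x^a ↦ χ(a) x^a` on Hahn series. -/
def weightMap (χ : Γ → R) : HahnSeries Γ R →ₗ[R] HahnSeries Γ R where
  toFun f :=
    { coeff := fun a => χ a * f.coeff a
      isPWO_support' := f.isPWO_support.mono fun _ ha => right_ne_zero_of_mul ha }
  map_add' f g := HahnSeries.ext (funext fun a => mul_add (χ a) (f.coeff a) (g.coeff a))
  map_smul' c f := HahnSeries.ext (funext fun a => mul_left_comm (χ a) c (f.coeff a))

theorem coeff_weightMap (χ : Γ → R) (f : HahnSeries Γ R) (a : Γ) :
    (weightMap χ f).coeff a = χ a * f.coeff a := rfl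

theorem support_weightMap_subset (χ : Γ → R) (f : HahnSeries Γ R) :
    (weightMap χ f).support ⊆ f.support :=
  fun _ ha => right_ne_zero_of_mul ha

variable [AddCommMonoid Γ] [IsOrderedCancelAddMonoid Γ]

/-- For an additive character `χ`, the map `x^a ↦ χ(a) x^a` is a derivation of Hahn series; for the
`j`-th coordinate function it is the Euler derivation `x_j ∂/∂x_j`. -/
def weightDerivation (χ : Γ →+ R) : Derivation R (HahnSeries Γ R) (HahnSeries Γ R) :=
  Derivation.mk' (weightMap χ) fun f g => by
    ext a
    rw [smul_eq_mul, smul_eq_mul, mul_comm g, HahnSeries.coeff_add, coeff_weightMap,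
      HahnSeries.coeff_mul_right' g.isPWO_support (support_weightMap_subset χ g),
      HahnSeries.coeff_mul_left' f.isPWO_support (support_weightMap_subset χ f),
      HahnSeries.coeff_mul, ← Finset.sum_add_distrib, Finset.mul_sum]
    refine Finset.sum_congr rfl fun b hb => ?_
    rw [coeff_weightMap, coeff_weightMap, ← (Finset.mem_antidiagonal.1 hb).2.2, map_add]
    ring

theorem coeff_weightDerivation (χ : Γ →+ R) (f : HahnSeries Γ R) (a : Γ) :
    (weightDerivation χ f).coeff a = χ a * f.coeff a := rfl

end Derivations

theorem map_derivation_of_forall_algebraMap {F R K L : Type*} [CommRing F] [CommRing R] [IsDomain R]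
    [Field K] [Algebra R K] [IsFractionRing R K] [CommRing L] [IsDomain L] [Algebra F K]
    [Algebra F L] (f : K →ₐ[F] L) (D : Derivation F K K) (D' : Derivation F L L)
    (h : ∀ P : R, f (D (algebraMap R K P)) = D' (f (algebraMap R K P))) (y : K) :
    f (D y) = D' (f y) := by
  obtain ⟨P, Q, hQ, rfl⟩ := IsFractionRing.div_surjective R y
  have hQK : algebraMap R K Q ≠ 0 := IsFractionRing.to_map_ne_zero_of_mem_nonZeroDivisors hQ
  have hQL : f (algebraMap R K Q) ≠ 0 := (map_ne_zero_iff _ f.toRingHom.injective).2 hQK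
  set y : K := algebraMap R K P / algebraMap R K Q
  have hP : algebraMap R K P = algebraMap R K Q * y := (mul_div_cancel₀ _ hQK).symm
  have hD := h P
  simp only [hP, Derivation.leibniz, map_mul, map_add, smul_eq_mul, h Q] at hD
  exact mul_left_cancel₀ hQL (add_right_cancel hD)

section Expansion

open MvPolynomial HahnSeries

/-- The degree `-u`, ordered lexicographically, in which the Laurent monomial `x^u` is placed when
rational functions are expanded as Hahn series. -/
def expDeg : (Fin r → ℤ) ≃+ Lex (Fin r → ℤ) := (AddEquiv.neg _).trans (toLexAddEquiv _)

/-- The exponent vector of a monomial, as an integer vector. -/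
def intExp : (Fin r →₀ ℕ) →+ (Fin r → ℤ) where
  toFun n j := n j
  map_zero' := rfl
  map_add' _ _ := funext fun _ => Nat.cast_add _ _

theorem intExp_injective : Function.Injective (intExp (r := r)) :=
  fun _ _ h => Finsupp.ext fun j => Int.ofNat_injective (congrFun h j)

theorem intExp_single (j : Fin r) (a : ℕ) :
    intExp (Finsupp.single j a) = Pi.single j (a : ℤ) := by
  ext i
  obtain rfl | h := eq_or_ne i j <;> simp [intExp, *]

/-- The expansion of polynomials as Hahn series. -/
def polyExpand (r : ℕ) : MvPolynomial (Fin r) ℂ →ₐ[ℂ] HahnSeries (Lex (Fin r → ℤ)) ℂ :=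
  aeval fun j => single (expDeg (Pi.single j 1)) 1

theorem polyExpand_monomial (n : Fin r →₀ ℕ) (c : ℂ) :
    polyExpand r (monomial n c) = single (expDeg (intExp n)) c := by
  induction n using Finsupp.induction_linear generalizing c with
  | zero =>
    rw [← MvPolynomial.C_apply, algHom_C, map_zero, map_zero]
    rfl
  | add m n hm hn =>
    rw [← mul_one c, ← monomial_mul, map_mul, hm, hn, single_mul_single, map_add, map_add]
  | single j a =>
    rw [← C_mul_X_pow_eq_monomial, map_mul, map_pow, polyExpand, aeval_X, algHom_C, single_pow,
      one_pow, intExp_single, HahnSeries.algebraMap_apply, HahnSeries.C_apply,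
      single_mul_single, zero_add, ← map_nsmul, ← Pi.single_smul]
    simp

theorem polyExpand_eq_sum (P : MvPolynomial (Fin r) ℂ) :
    polyExpand r P = ∑ n ∈ P.support, single (expDeg (intExp n)) (P.coeff n) := by
  conv_lhs => rw [P.as_sum, map_sum]
  exact Finset.sum_congr rfl fun n _ => polyExpand_monomial n _

theorem coeff_polyExpand (P : MvPolynomial (Fin r) ℂ) (n : Fin r →₀ ℕ) :
    (polyExpand r P).coeff (expDeg (intExp n)) = P.coeff n := by
  rw [polyExpand_eq_sum, HahnSeries.coeff_sum]
  simp only [coeff_single, expDeg.injective.eq_iff, intExp_injective.eq_iff, Finset.sum_ite_eq,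
    mem_support_iff, ite_not]
  exact ite_eq_right_iff.2 Eq.symm

theorem coeff_polyExpand_of_notMem_range (P : MvPolynomial (Fin r) ℂ) {u : Fin r → ℤ}
    (hu : u ∉ Set.range intExp) : (polyExpand r P).coeff (expDeg u) = 0 := by
  rw [polyExpand_eq_sum, HahnSeries.coeff_sum]
  exact Finset.sum_eq_zero fun n _ => coeff_single_of_ne fun h => hu ⟨n, (expDeg.injective h).symm⟩

theorem polyExpand_injective (r : ℕ) : Function.Injective (polyExpand r) := by
  refine (injective_iff_map_eq_zero _).2 fun P hP => ?_
  ext n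
  rw [← coeff_polyExpand, hP, HahnSeries.coeff_zero, MvPolynomial.coeff_zero]

/-- The expansion of rational functions as Hahn series. -/
def expand (r : ℕ) : RatFun r →ₐ[ℂ] HahnSeries (Lex (Fin r → ℤ)) ℂ :=
  IsFractionRing.liftAlgHom (polyExpand_injective r)

theorem expand_ofPoly (P : MvPolynomial (Fin r) ℂ) : expand r (ofPoly P) = polyExpand r P :=
  IsFractionRing.lift_algebraMap (polyExpand_injective r) P

theorem expand_var (j : Fin r) : expand r (var j) = single (expDeg (Pi.single j 1)) 1 := by
  rw [expand_ofPoly, polyExpand, aeval_X]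

/-- The coefficient of `x^u` in the expansion of a rational function. -/
def expCoeff (u : Fin r → ℤ) : RatFun r →ₗ[ℂ] ℂ :=
  coeff.linearMap (expDeg u) ∘ₗ (expand r).toLinearMap

theorem expCoeff_apply (u : Fin r → ℤ) (φ : RatFun r) :
    expCoeff u φ = (expand r φ).coeff (expDeg u) := rfl

theorem expCoeff_ext {φ ψ : RatFun r} (h : ∀ u, expCoeff u φ = expCoeff u ψ) : φ = ψ := by
  refine (expand r).toRingHom.injective (HahnSeries.ext (funext fun a => ?_))
  obtain ⟨u, rfl⟩ := expDeg.surjective a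
  exact h u

theorem expCoeff_var_mul (j : Fin r) (φ : RatFun r) (u : Fin r → ℤ) :
    expCoeff u (var j * φ) = expCoeff (u - Pi.single j 1) φ := by
  rw [expCoeff_apply, map_mul, expand_var, coeff_single_mul, one_mul, expCoeff_apply, map_sub]

theorem partialD_ofPoly (j : Fin r) (P : MvPolynomial (Fin r) ℂ) :
    partialD j (ofPoly P) = ofPoly (pderiv j P) := by
  simpa [partialD] using fracDeriv_div (K := RatFun r) (pderiv (R := ℂ) j) P 1 one_ne_zero

/-- The character of the lexicographic exponents whose weight derivation is `x_j ∂/∂x_j`. -/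
def coordChar (j : Fin r) : Lex (Fin r → ℤ) →+ ℂ :=
  (Int.castAddHom ℂ).comp ((Pi.evalAddMonoidHom _ j).comp expDeg.symm.toAddMonoidHom)

theorem coordChar_expDeg (j : Fin r) (u : Fin r → ℤ) : coordChar j (expDeg u) = u j := by
  simp [coordChar]

theorem polyExpand_X_mul_pderiv (j : Fin r) (P : MvPolynomial (Fin r) ℂ) :
    polyExpand r (X j * pderiv j P) = weightDerivation (coordChar j) (polyExpand r P) := by
  induction P using MvPolynomial.induction_on' with
  | monomial n c =>
    rw [X_mul_pderiv_monomial, map_nsmul, polyExpand_monomial]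
    ext a
    rw [coeff_weightDerivation, HahnSeries.coeff_smul, nsmul_eq_mul]
    by_cases ha : a = expDeg (intExp n)
    · rw [ha, coordChar_expDeg]
      rfl
    · rw [coeff_single_of_ne ha, mul_zero, mul_zero]
  | add p q hp hq => rw [map_add, mul_add, map_add, map_add, map_add, hp, hq]

theorem expCoeff_var_mul_partialD (j : Fin r) (φ : RatFun r) (u : Fin r → ℤ) :
    expCoeff u (var j * partialD j φ) = (u j : ℂ) * expCoeff u φ := by
  have h := map_derivation_of_forall_algebraMap (expand r) ((var j : RatFun r) • partialD j)
    (weightDerivation (coordChar j)) (fun P => by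
      rw [Derivation.smul_apply, partialD_ofPoly, smul_eq_mul, ← map_mul, expand_ofPoly,
        expand_ofPoly, polyExpand_X_mul_pderiv]) φ
  rw [expCoeff_apply, ← smul_eq_mul (var j), ← Derivation.smul_apply, h, coeff_weightDerivation,
    coordChar_expDeg, expCoeff_apply]

theorem expCoeff_partialD (j : Fin r) (φ : RatFun r) (u : Fin r → ℤ) :
    expCoeff u (partialD j φ) = ((u j : ℂ) + 1) * expCoeff (u + Pi.single j 1) φ := by
  have h := expCoeff_var_mul_partialD j φ (u + Pi.single j 1)
  rwa [expCoeff_var_mul, add_sub_cancel_right, Pi.add_apply, Pi.single_eq_same, Int.cast_add,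
    Int.cast_one] at h

/-! ### Coefficients normalized by factorials -/

/-- The negative support of an exponent vector. -/
def negSupp (u : Fin r → ℤ) : Finset (Fin r) := {j | u j < 0}

theorem mem_negSupp {u : Fin r → ℤ} {j : Fin r} : j ∈ negSupp u ↔ u j < 0 := by
  simp [negSupp]

theorem negSupp_anti {u u' : Fin r → ℤ} (h : u ≤ u') : negSupp u' ⊆ negSupp u :=
  fun j hj => mem_negSupp.2 ((h j).trans_lt (mem_negSupp.1 hj))

theorem negSupp_inf (u u' : Fin r → ℤ) : negSupp (u ⊓ u') = negSupp u ∪ negSupp u' := by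
  ext j
  simp only [Finset.mem_union, mem_negSupp, Pi.inf_apply, inf_lt_iff]

theorem negSupp_eq_empty_iff {u : Fin r → ℤ} : negSupp u = ∅ ↔ u ∈ Set.range intExp := by
  constructor
  · intro h
    have hu : ∀ j, 0 ≤ u j := fun j => not_lt.1 fun hj => by simpa [h] using mem_negSupp.2 hj
    exact ⟨Finsupp.equivFunOnFinite.symm fun j => (u j).toNat,
      funext fun j => Int.toNat_of_nonneg (hu j)⟩
  · rintro ⟨n, rfl⟩
    exact Finset.filter_false_of_mem fun j _ => not_lt.2 (Int.natCast_nonneg (n j))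

/-- The function `γ` with `(n + 1) γ(n + 1) = γ(n)` for `n ≠ -1`, given by `γ(n) = 1 / n!` for
`n ≥ 0` and `γ(-n-1) = (-1)^(n+1) n!`. It extends the coefficients of the exponential series to
negative exponents. The recurrence leaves the sign of `γ(-1)` open; with `γ(-1) = -1` the values
are the coefficients in `psiLast` and `psiZero`. -/
def invFact : ℤ → ℚ
  | Int.ofNat n => (n.factorial : ℚ)⁻¹
  | Int.negSucc n => (-1) ^ (n + 1) * n.factorial

theorem invFact_natCast (n : ℕ) : invFact n = (n.factorial : ℚ)⁻¹ := rfl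

theorem invFact_negSucc (n : ℕ) : invFact (Int.negSucc n) = (-1) ^ (n + 1) * n.factorial := rfl

theorem invFact_ne_zero : ∀ n : ℤ, invFact n ≠ 0
  | Int.ofNat n => inv_ne_zero (Nat.cast_ne_zero.2 n.factorial_ne_zero)
  | Int.negSucc n => mul_ne_zero (pow_ne_zero _ (by norm_num))
      (Nat.cast_ne_zero.2 n.factorial_ne_zero)

theorem succ_mul_invFact {n : ℤ} (hn : n ≠ -1) : ((n : ℚ) + 1) * invFact (n + 1) = invFact n := by
  match n with
  | Int.ofNat n =>
    have h : (Int.ofNat n + 1 : ℤ) = (n + 1 : ℕ) := rfl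
    have : (n.factorial : ℚ) ≠ 0 := Nat.cast_ne_zero.2 n.factorial_ne_zero
    rw [h, invFact_natCast, Int.ofNat_eq_natCast, invFact_natCast, Nat.factorial_succ]
    push_cast
    field_simp
  | Int.negSucc 0 => exact absurd rfl hn
  | Int.negSucc (n + 1) =>
    have h : (Int.negSucc (n + 1) + 1 : ℤ) = Int.negSucc n := by omega
    rw [h, invFact_negSucc, invFact_negSucc, Nat.factorial_succ, Int.cast_negSucc]
    push_cast
    ring

/-- The product of the values of `invFact` over the coordinates. -/
def invFactProd (u : Fin r → ℤ) : ℚ := ∏ j, invFact (u j)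

theorem invFactProd_ne_zero (u : Fin r → ℤ) : invFactProd u ≠ 0 :=
  Finset.prod_ne_zero_iff.2 fun _ _ => invFact_ne_zero _

theorem succ_mul_invFactProd {u : Fin r → ℤ} {j : Fin r} (hj : u j ≠ -1) :
    ((u j : ℚ) + 1) * invFactProd (u + Pi.single j 1) = invFactProd u := by
  have h : ∏ i ∈ Finset.univ.erase j, invFact ((u + Pi.single j 1 : Fin r → ℤ) i) =
      ∏ i ∈ Finset.univ.erase j, invFact (u i) :=
    Finset.prod_congr rfl fun i hi => by
      rw [Pi.add_apply, Pi.single_eq_of_ne (Finset.ne_of_mem_erase hi), add_zero]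
  rw [invFactProd, invFactProd, ← Finset.mul_prod_erase _ _ (Finset.mem_univ j),
    ← Finset.mul_prod_erase _ _ (Finset.mem_univ j), h, ← mul_assoc, Pi.add_apply,
    Pi.single_eq_same, succ_mul_invFact hj]

/-- The coefficient of `γ(u) x^u` in the expansion of a rational function, where `γ(u)` is
`invFactProd u`. With this normalization every `∂_j` acts as a shift, except that it annihilates the
terms with `u_j = 0`. -/
def normCoeff (u : Fin r → ℤ) : RatFun r →ₗ[ℂ] ℂ := (invFactProd u : ℂ)⁻¹ • expCoeff u

theorem expCoeff_eq_invFactProd_mul_normCoeff (u : Fin r → ℤ) (φ : RatFun r) :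
    expCoeff u φ = invFactProd u * normCoeff u φ :=
  (mul_inv_cancel_left₀ (Rat.cast_ne_zero.2 (invFactProd_ne_zero u)) _).symm

theorem normCoeff_ext {φ ψ : RatFun r} (h : ∀ u, normCoeff u φ = normCoeff u ψ) : φ = ψ :=
  expCoeff_ext fun u => by
    rw [expCoeff_eq_invFactProd_mul_normCoeff, h, expCoeff_eq_invFactProd_mul_normCoeff]

theorem normCoeff_var_mul_partialD (j : Fin r) (φ : RatFun r) (u : Fin r → ℤ) :
    normCoeff u (var j * partialD j φ) = u j * normCoeff u φ := by
  rw [normCoeff, LinearMap.smul_apply, LinearMap.smul_apply, expCoeff_var_mul_partialD,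
    smul_eq_mul, smul_eq_mul, mul_left_comm]

theorem normCoeff_partialD (j : Fin r) (φ : RatFun r) (u : Fin r → ℤ) :
    normCoeff u (partialD j φ) = if u j = -1 then 0 else normCoeff (u + Pi.single j 1) φ := by
  have hγ : (invFactProd u : ℂ) ≠ 0 := Rat.cast_ne_zero.2 (invFactProd_ne_zero u)
  refine mul_left_cancel₀ hγ ?_
  rw [← expCoeff_eq_invFactProd_mul_normCoeff, expCoeff_partialD]
  split_ifs with h
  · simp [h]
  · rw [expCoeff_eq_invFactProd_mul_normCoeff, ← mul_assoc, ← succ_mul_invFactProd h]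
    push_cast
    rfl

theorem normCoeff_partialD_pow (j : Fin r) (a : ℕ) (φ : RatFun r) (u : Fin r → ℤ) :
    normCoeff u (((partialD j : RatFun r →ₗ[ℂ] RatFun r) ^ a) φ) =
      if (u j + a < 0 ↔ u j < 0) then normCoeff (u + Pi.single j (a : ℤ)) φ else 0 := by
  induction a generalizing u with
  | zero => simp
  | succ a ih =>
    rw [pow_succ', Module.End.mul_apply, Derivation.coeFn_coe, normCoeff_partialD, ih, add_assoc,
      ← Pi.single_add, ← ite_not, ← ite_and, Pi.add_apply, Pi.single_eq_same, Nat.cast_succ,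
      add_comm (1 : ℤ)]
    exact if_congr (by omega) rfl rfl

theorem normCoeff_prod_partialD_pow (w : Fin r → ℕ) (φ : RatFun r) {l : List (Fin r)}
    (hl : l.Nodup) (u : Fin r → ℤ) :
    normCoeff u ((l.map fun j => (partialD j : RatFun r →ₗ[ℂ] RatFun r) ^ w j).prod φ) =
      if ∀ j ∈ l, (u j + w j < 0 ↔ u j < 0) then
        normCoeff (u + (l.map fun j => (Pi.single j (w j : ℤ) : Fin r → ℤ)).sum) φ else 0 := by
  induction l generalizing u with
  | nil => simp
  | cons a l ih =>
    obtain ⟨ha, hl⟩ := List.nodup_cons.1 hl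
    have hu : ∀ j ∈ l, (u + Pi.single a (w a : ℤ) : Fin r → ℤ) j = u j := fun j hj => by
      rw [Pi.add_apply, Pi.single_eq_of_ne (ne_of_mem_of_not_mem hj ha), add_zero]
    simp only [List.map_cons, List.prod_cons, List.sum_cons, Module.End.mul_apply,
      List.forall_mem_cons]
    rw [normCoeff_partialD_pow, ih hl, add_assoc, ← ite_and]
    exact if_congr (and_congr_right' (forall₂_congr fun j hj => by rw [hu j hj])) rfl rfl

theorem normCoeff_iterD (w : Fin r → ℕ) (φ : RatFun r) (u : Fin r → ℤ) :
    normCoeff u (iterD w φ) =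
      if negSupp (u + fun j => (w j : ℤ)) = negSupp u then normCoeff (u + fun j => (w j : ℤ)) φ
      else 0 := by
  have hsum : ((List.finRange r).map fun j => (Pi.single j (w j : ℤ) : Fin r → ℤ)).sum =
      fun j => (w j : ℤ) := by
    rw [← List.ofFn_eq_map, List.sum_ofFn]
    exact Finset.univ_sum_single _
  rw [iterD, List.ofFn_eq_map, normCoeff_prod_partialD_pow w φ (List.nodup_finRange r), hsum]
  exact if_congr (by simp [Finset.ext_iff, mem_negSupp]) rfl rfl

theorem expCoeff_ofPoly_intExp (P : MvPolynomial (Fin r) ℂ) (n : Fin r →₀ ℕ) :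
    expCoeff (intExp n) (ofPoly P) = P.coeff n := by
  rw [expCoeff_apply, expand_ofPoly, coeff_polyExpand]

theorem normCoeff_ofPoly_eq_zero (P : MvPolynomial (Fin r) ℂ) {u : Fin r → ℤ}
    (hu : negSupp u ≠ ∅) : normCoeff u (ofPoly P) = 0 := by
  rw [normCoeff, LinearMap.smul_apply, expCoeff_apply, expand_ofPoly,
    coeff_polyExpand_of_notMem_range P (mt negSupp_eq_empty_iff.2 hu), smul_zero]

end Expansion

/-! ### Canonical series -/

section Solutions

variable {A : Matrix (Fin n) (Fin r) ℤ} {φ : RatFun r}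

theorem euler_iff_normCoeff {α : Fin n → ℂ} :
    (∀ i, ∑ j, A i j • (var j * partialD j φ) = α i • φ) ↔
      ∀ u, normCoeff u φ ≠ 0 → (fun i => (A.mulVec u i : ℂ)) = α := by
  have key : ∀ i u, normCoeff u (∑ j, A i j • (var j * partialD j φ)) =
      (A.mulVec u i : ℂ) * normCoeff u φ := fun i u => by
    rw [map_sum, Matrix.mulVec, dotProduct, Int.cast_sum, Finset.sum_mul]
    refine Finset.sum_congr rfl fun j _ => ?_
    rw [map_zsmul, normCoeff_var_mul_partialD, zsmul_eq_mul, ← mul_assoc, Int.cast_mul]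
  refine ⟨fun h u hu => funext fun i => mul_right_cancel₀ hu ?_,
    fun h i => normCoeff_ext fun u => ?_⟩
  · rw [← key, h i, map_smul, smul_eq_mul]
  · rw [key, map_smul, smul_eq_mul]
    by_cases hu : normCoeff u φ = 0
    · rw [hu, mul_zero, mul_zero]
    · rw [← h u hu]

theorem normCoeff_toricOp (φ : RatFun r) (v w : Fin r → ℤ) :
    normCoeff w (toricOp v φ) =
      (if negSupp (w + v⁺) = negSupp w then normCoeff (w + v⁺) φ else 0) -
        if negSupp (w + v⁻) = negSupp w then normCoeff (w + v⁻) φ else 0 := by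
  have hpos : (fun j => ((v j).toNat : ℤ)) = v⁺ := funext fun j => Int.toNat_eq_max (v j)
  have hneg : (fun j => ((-v j).toNat : ℤ)) = v⁻ := funext fun j => Int.toNat_eq_max (-v j)
  rw [toricOp, LinearMap.sub_apply, map_sub, normCoeff_iterD, normCoeff_iterD, hpos, hneg]

theorem toric_iff_normCoeff :
    (∀ v, A.mulVec v = 0 → toricOp v φ = 0) ↔
      ∀ u u', A.mulVec u = A.mulVec u' → negSupp u ⊆ negSupp u' →
        normCoeff u' φ = if negSupp u = negSupp u' then normCoeff u φ else 0 := by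
  constructor
  · intro h u u' hA hs
    have h0 := congrArg (normCoeff (u ⊓ u')) (h (u - u') (by rw [Matrix.mulVec_sub, hA, sub_self]))
    have hu : u ⊓ u' + (u - u')⁺ = u := by rw [inf_eq_sub_posPart_sub, sub_add_cancel]
    have hu' : u ⊓ u' + (u - u')⁻ = u' := by
      rw [inf_comm, inf_eq_sub_posPart_sub, ← posPart_neg, neg_sub, sub_add_cancel]
    rw [normCoeff_toricOp, map_zero, sub_eq_zero, hu, hu', negSupp_inf,
      Finset.union_eq_right.2 hs, if_pos rfl] at h0
    exact h0.symm
  · refine fun h v hv => normCoeff_ext fun w => ?_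
    rw [normCoeff_toricOp, map_zero, sub_eq_zero]
    have hA : A.mulVec (w + v⁺) = A.mulVec (w + v⁻) := by
      rw [← sub_eq_zero, ← Matrix.mulVec_sub, add_sub_add_left_eq_sub, posPart_sub_negPart, hv]
    have hpos : negSupp (w + v⁺) ⊆ negSupp w :=
      negSupp_anti (le_add_of_nonneg_right (posPart_nonneg v))
    have hneg : negSupp (w + v⁻) ⊆ negSupp w :=
      negSupp_anti (le_add_of_nonneg_right (negPart_nonneg v))
    split_ifs with hu hu' hu'
    · rw [h _ _ hA (by rw [hu, hu']), if_pos (by rw [hu, hu'])]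
    · rw [h _ _ hA.symm (by rwa [hu]), if_neg (by rwa [hu])]
    · rw [h _ _ hA (by rwa [hu']), if_neg (by rwa [hu'])]
    · rfl

theorem IsRationalSolution.add {α : Fin n → ℂ} {ψ : RatFun r} (hφ : IsRationalSolution A α φ)
    (hψ : IsRationalSolution A α ψ) : IsRationalSolution A α (φ + ψ) where
  toric v hv := by rw [map_add, hφ.toric v hv, hψ.toric v hv, add_zero]
  euler i := by
    simp only [map_add, mul_add, smul_add, Finset.sum_add_distrib, hφ.euler i, hψ.euler i]

theorem IsRationalSolution.smul {α : Fin n → ℂ} (hφ : IsRationalSolution A α φ) (c : ℂ) :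
    IsRationalSolution A α (c • φ) where
  toric v hv := by rw [map_smul, hφ.toric v hv, smul_zero]
  euler i := by
    rw [smul_comm, ← hφ.euler i, Finset.smul_sum]
    simp only [Derivation.map_smul, mul_smul_comm, smul_comm c]

theorem IsRationalSolution.mulVec_eq {α : Fin n → ℤ}
    (h : IsRationalSolution A (fun i => (α i : ℂ)) φ) {u : Fin r → ℤ} (hu : normCoeff u φ ≠ 0) :
    A.mulVec u = α :=
  funext fun i => Int.cast_injective (congrFun (euler_iff_normCoeff.1 h.euler u hu) i)

theorem isRationalSolution_iff_eq_zero {α : Fin n → ℂ}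
    (hα : ¬ ∃ a : Fin n → ℤ, α = fun i => (a i : ℂ)) : IsRationalSolution A α φ ↔ φ = 0 := by
  constructor
  · refine fun h => normCoeff_ext fun u => ?_
    rw [map_zero]
    by_contra hu
    exact hα ⟨A.mulVec u, (euler_iff_normCoeff.1 h.euler u hu).symm⟩
  · rintro rfl
    exact ⟨fun v _ => map_zero _, fun i => by simp⟩

theorem IsRationalSolution.negSupp_eq_of_subset {α : Fin n → ℤ}
    (h : IsRationalSolution A (fun i => (α i : ℂ)) φ) {u u' : Fin r → ℤ} (hu : A.mulVec u = α)
    (hu' : normCoeff u' φ ≠ 0) (hs : negSupp u ⊆ negSupp u') : negSupp u = negSupp u' := by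
  by_contra hne
  exact hu' (by rw [toric_iff_normCoeff.1 h.toric u u' (hu.trans (h.mulVec_eq hu').symm) hs,
    if_neg hne])

theorem IsRationalSolution.normCoeff_eq {α : Fin n → ℂ} (h : IsRationalSolution A α φ)
    {u u' : Fin r → ℤ} (hA : A.mulVec u = A.mulVec u') (hs : negSupp u = negSupp u') :
    normCoeff u φ = normCoeff u' φ := by
  rw [toric_iff_normCoeff.1 h.toric u u' hA hs.subset, if_pos hs]

/-- The exponents `u` with `A u = α` and negative support `I`. -/
def expClass (A : Matrix (Fin n) (Fin r) ℤ) (α : Fin n → ℤ) (I : Finset (Fin r)) :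
    Set (Fin r → ℤ) :=
  {u | A.mulVec u = α ∧ negSupp u = I}

/-- `φ` expands as the sum of `γ(u) x^u` over the exponents `u` with `A u = α` and negative support
`I`. These are the series denoted `φ_v` by Saito, Sturmfels and Takayama. -/
def IsCanonicalSeries (A : Matrix (Fin n) (Fin r) ℤ) (α : Fin n → ℤ) (I : Finset (Fin r))
    (φ : RatFun r) : Prop :=
  ∀ u, normCoeff u φ = (expClass A α I).indicator 1 u

variable {α : Fin n → ℤ} {I : Finset (Fin r)}

theorem IsCanonicalSeries.normCoeff_ne_zero_iff (hφ : IsCanonicalSeries A α I φ)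
    {u : Fin r → ℤ} : normCoeff u φ ≠ 0 ↔ A.mulVec u = α ∧ negSupp u = I := by
  rw [hφ u, Set.indicator_apply_ne_zero, Function.support_one, Set.inter_univ]
  rfl

theorem IsCanonicalSeries.isRationalSolution (hφ : IsCanonicalSeries A α I φ)
    (hI : ∀ u, A.mulVec u = α → negSupp u ⊆ I → negSupp u = I) :
    IsRationalSolution A (fun i => (α i : ℂ)) φ where
  toric := by
    refine toric_iff_normCoeff.2 fun u u' hA hs => ?_
    by_cases hu' : normCoeff u' φ = 0
    · rw [hu', eq_comm, ite_eq_right_iff]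
      intro hne
      by_contra hu
      have hu := hφ.normCoeff_ne_zero_iff.1 hu
      rw [hA, hne] at hu
      exact hφ.normCoeff_ne_zero_iff.2 hu hu'
    · obtain ⟨hα, rfl⟩ := hφ.normCoeff_ne_zero_iff.1 hu'
      have hu := hI u (hA.trans hα) hs
      have hmem : u ∈ expClass A α (negSupp u') := ⟨hA.trans hα, hu⟩
      have hmem' : u' ∈ expClass A α (negSupp u') := ⟨hα, rfl⟩
      rw [if_pos hu, hφ, hφ, Set.indicator_of_mem hmem, Set.indicator_of_mem hmem']
      rfl
  euler := euler_iff_normCoeff.2 fun u hu => by rw [(hφ.normCoeff_ne_zero_iff.1 hu).1]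

theorem IsRationalSolution.isCanonicalSeries_inv_smul
    (h : IsRationalSolution A (fun i => (α i : ℂ)) φ) {u : Fin r → ℤ} (hu : normCoeff u φ ≠ 0)
    (hI : ∀ u', normCoeff u' φ ≠ 0 → negSupp u' ⊆ negSupp u) :
    IsCanonicalSeries A α (negSupp u) ((normCoeff u φ)⁻¹ • φ) := by
  intro u'
  rw [map_smul, smul_eq_mul]
  by_cases hu' : u' ∈ expClass A α (negSupp u)
  · rw [Set.indicator_of_mem hu', h.normCoeff_eq (hu'.1.trans (h.mulVec_eq hu).symm) hu'.2,
      inv_mul_cancel₀ hu]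
    rfl
  · rw [Set.indicator_of_notMem hu', mul_eq_zero]
    by_contra! hne
    exact hu' ⟨h.mulVec_eq hne.2,
      h.negSupp_eq_of_subset (h.mulVec_eq hne.2) hu (hI u' hne.2)⟩

theorem IsRationalSolution.exists_eq_sum_smul {ι : Type*} {s : Finset ι} {I : ι → Finset (Fin r)}
    {ψ : ι → RatFun r} (h : IsRationalSolution A (fun i => (α i : ℂ)) φ)
    (hψ : ∀ i ∈ s, IsCanonicalSeries A α (I i) (ψ i)) (hI : Set.InjOn I s)
    (hs : ∀ u, normCoeff u φ ≠ 0 → ∃ i ∈ s, negSupp u = I i) :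
    ∃ c : ι → ℂ, φ = ∑ i ∈ s, c i • ψ i := by
  classical
  refine ⟨fun i => if hne : (expClass A α (I i)).Nonempty then normCoeff hne.some φ else 0,
    normCoeff_ext fun u => ?_⟩
  rw [map_sum]
  simp only [map_smul, smul_eq_mul]
  by_cases hu : ∃ i ∈ s, u ∈ expClass A α (I i)
  · obtain ⟨i, hi, hui⟩ := hu
    have hne : (expClass A α (I i)).Nonempty := ⟨u, hui⟩
    rw [Finset.sum_eq_single_of_mem i hi, dif_pos hne, hψ i hi, Set.indicator_of_mem hui,
      Pi.one_apply, mul_one]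
    · exact h.normCoeff_eq (hui.1.trans hne.some_mem.1.symm) (hui.2.trans hne.some_mem.2.symm)
    · intro j hj hji
      rw [hψ j hj, Set.indicator_of_notMem, mul_zero]
      exact fun huj => hji (hI hj hi (huj.2.symm.trans hui.2))
  · push Not at hu
    rw [Finset.sum_eq_zero fun i hi => by
      rw [hψ i hi, Set.indicator_of_notMem (hu i hi), mul_zero]]
    by_contra hne
    obtain ⟨i, hi, hui⟩ := hs u hne
    exact hu i hi ⟨h.mulVec_eq hne, hui⟩

end Solutions

/-! ### Integrality of the coefficients of an expansion -/

theorem map_mul_map_algebraMap {Γ R S : Type*} [AddCommMonoid Γ] [PartialOrder Γ]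
    [IsOrderedCancelAddMonoid Γ] [CommRing R] [CommRing S] [Algebra R S] (l : S →ₗ[R] R)
    (g : HahnSeries Γ S) (f : HahnSeries Γ R) :
    (g * f.map (algebraMap R S)).map l = g.map l * f := by
  ext a
  rw [HahnSeries.map_coeff,
    HahnSeries.coeff_mul_right' (y := f.map (algebraMap R S)) f.isPWO_support
      (HahnSeries.support_map_subset f (algebraMap R S : ZeroHom R S)),
    HahnSeries.coeff_mul_left' (x := g.map l) g.isPWO_support
      (HahnSeries.support_map_subset g (l : ZeroHom S R)), map_sum]
  refine Finset.sum_congr rfl fun ij _ => ?_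
  rw [HahnSeries.map_coeff, HahnSeries.map_coeff, mul_comm, ← Algebra.smul_def, map_smul,
    smul_eq_mul, mul_comm]

section HahnSeries

variable {Γ K : Type*} [AddCommMonoid Γ] [LinearOrder Γ] [IsOrderedCancelAddMonoid Γ]

theorem coeff_mem_subring_of_mul_eq [Field K] {O : Subring K} {f g h : HahnSeries Γ K}
    (hgf : g * f = h) (hg0 : g ≠ 0) (hg : ∀ a, g.coeff a ∈ O) (hh : ∀ a, h.coeff a ∈ O)
    (hlead : g.leadingCoeff⁻¹ ∈ O) (a : Γ) : f.coeff a ∈ O := by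
  by_contra ha
  have hS : {a | f.coeff a ∉ O}.IsWF :=
    f.isWF_support.mono fun b hb hb0 => hb (by rw [hb0]; exact O.zero_mem)
  have hne : {a | f.coeff a ∉ O}.Nonempty := ⟨a, ha⟩
  set b := hS.min hne
  have hb : f.coeff b ∉ O := hS.min_mem hne
  have hlead0 : g.leadingCoeff ≠ 0 := HahnSeries.leadingCoeff_ne_zero.2 hg0
  -- By minimality of `b`, the leading term of `g` times the `b`-term of `f` is the only
  -- contribution to the coefficient of `h` at `g.order + b` that can leave `O`.
  have hmem : (g.order, b) ∈
      Finset.antidiagonal g.isPWO_support f.isPWO_support (g.order + b) :=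
    Finset.mem_antidiagonal.2 ⟨mt HahnSeries.coeff_order_eq_zero.1 hg0,
      fun hb0 => hb (by rw [hb0]; exact O.zero_mem), rfl⟩
  have hsum := congrArg (fun h => HahnSeries.coeff h (g.order + b)) hgf
  simp only [HahnSeries.coeff_mul] at hsum
  rw [← Finset.add_sum_erase _ _ hmem, ← eq_sub_iff_add_eq, ← HahnSeries.leadingCoeff_eq] at hsum
  have hrest : ∀ ij ∈ (Finset.antidiagonal g.isPWO_support f.isPWO_support (g.order + b)).erase
      (g.order, b), g.coeff ij.1 * f.coeff ij.2 ∈ O := by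
    rintro ⟨i, j⟩ hij
    obtain ⟨hij_ne, hij⟩ := Finset.mem_erase.1 hij
    obtain ⟨hi, -, hij⟩ := Finset.mem_antidiagonal.1 hij
    refine O.mul_mem (hg i) (of_not_not fun hjO => hij_ne ?_)
    have hbj : b ≤ j := hS.min_le hne hjO
    have hgi : g.order ≤ i := HahnSeries.order_le_of_coeff_ne_zero hi
    obtain rfl : g.order = i :=
      hgi.eq_of_not_lt fun hlt => (add_lt_add_of_lt_of_le hlt hbj).ne hij.symm
    exact Prod.ext rfl (add_left_cancel hij)
  refine hb ?_
  rw [← inv_mul_cancel_left₀ hlead0 (f.coeff b), hsum]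
  exact O.mul_mem hlead (O.sub_mem (hh _) (O.sum_mem hrest))

theorem exists_finset_coeff_mem_closure_of_mul_eq [Field K] {f g h : HahnSeries Γ K}
    (hgf : g * f = h) (hg0 : g ≠ 0) (hg : (Set.range g.coeff).Finite)
    (hh : (Set.range h.coeff).Finite) :
    ∃ T : Finset K, ∀ a, f.coeff a ∈ Subring.closure (T : Set K) := by
  classical
  refine ⟨insert g.leadingCoeff⁻¹ (hg.toFinset ∪ hh.toFinset),
    coeff_mem_subring_of_mul_eq hgf hg0 (fun a => ?_) (fun a => ?_) ?_⟩ <;>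
  exact Subring.subset_closure (by simp)

theorem exists_finset_coeff_mem_closure_of_mul_map_eq {F : Type*} [Field F] [Field K] [Algebra F K]
    {f : HahnSeries Γ F} {g h : HahnSeries Γ K} (hgf : g * f.map (algebraMap F K) = h)
    (hg0 : g ≠ 0) (hg : (Set.range g.coeff).Finite) (hh : (Set.range h.coeff).Finite) :
    ∃ T : Finset F, ∀ a, f.coeff a ∈ Subring.closure (T : Set F) := by
  -- An `F`-linear functional turns the equation over `K` into one over `F` with the same `f`.
  obtain ⟨l, hl⟩ : ∃ l : Module.Dual F K, l g.leadingCoeff ≠ 0 := by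
    by_contra! hl
    exact HahnSeries.leadingCoeff_ne_zero.2 hg0 ((Module.forall_dual_apply_eq_zero_iff F _).1 hl)
  have range_map : ∀ x : HahnSeries Γ K, Set.range (x.map l).coeff = l '' Set.range x.coeff :=
    fun x => Set.range_comp l x.coeff
  refine exists_finset_coeff_mem_closure_of_mul_eq (g := g.map l) (h := h.map l) ?_
    (fun h0 => hl ?_) (range_map g ▸ hg.image l) (range_map h ▸ hh.image l)
  · rw [← hgf, map_mul_map_algebraMap]
  · rw [HahnSeries.leadingCoeff_eq, ← HahnSeries.map_coeff, h0, HahnSeries.coeff_zero]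

end HahnSeries

section Integrality

open MvPolynomial HahnSeries

theorem finite_range_coeff_polyExpand (P : MvPolynomial (Fin r) ℂ) :
    (Set.range (polyExpand r P).coeff).Finite := by
  have hP : (Set.range P.coeff).Finite := Finsupp.finite_range _
  refine (hP.insert 0).subset ?_
  rintro _ ⟨a, rfl⟩
  obtain ⟨u, rfl⟩ := expDeg.surjective a
  by_cases hu : u ∈ Set.range intExp
  · obtain ⟨n, rfl⟩ := hu
    exact Or.inr ⟨n, (coeff_polyExpand P n).symm⟩
  · exact Or.inl (coeff_polyExpand_of_notMem_range P hu)

theorem exists_finset_mem_closure_of_expCoeff_eq {φ : RatFun r} {c : (Fin r → ℤ) → ℚ}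
    (hc : ∀ u, expCoeff u φ = c u) :
    ∃ T : Finset ℚ, ∀ u, c u ∈ Subring.closure (T : Set ℚ) := by
  obtain ⟨P, Q, hQ, hφ⟩ := IsFractionRing.div_surjective (MvPolynomial (Fin r) ℂ) φ
  have hφ : ofPoly Q * φ = ofPoly P := by
    rw [← hφ, mul_div_cancel₀ _ (IsFractionRing.to_map_ne_zero_of_mem_nonZeroDivisors hQ)]
  have hcoeff : ∀ a, (expand r φ).coeff a = c (expDeg.symm a) := fun a => by
    rw [← hc, expCoeff_apply, AddEquiv.apply_symm_apply]
  let f : HahnSeries (Lex (Fin r → ℤ)) ℚ :=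
    { coeff := fun a => c (expDeg.symm a)
      isPWO_support' := (expand r φ).isPWO_support.mono fun a ha => by
        rw [mem_support, hcoeff]
        exact Rat.cast_ne_zero.2 ha }
  have hf : f.map (algebraMap ℚ ℂ) = expand r φ := HahnSeries.ext (funext fun a => (hcoeff a).symm)
  obtain ⟨T, hT⟩ := exists_finset_coeff_mem_closure_of_mul_map_eq (f := f) (g := polyExpand r Q)
    (h := polyExpand r P) (by rw [hf, ← expand_ofPoly, ← map_mul, hφ, expand_ofPoly])
    ((map_ne_zero_iff _ (polyExpand_injective r)).2 (nonZeroDivisors.ne_zero hQ))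
    (finite_range_coeff_polyExpand Q) (finite_range_coeff_polyExpand P)
  exact ⟨T, fun u => by simpa [f] using hT (expDeg u)⟩

theorem eventually_padicNorm_le_one_of_mem_closure (T : Finset ℚ) :
    ∀ᶠ p : ℕ in Filter.atTop, p.Prime → ∀ x ∈ Subring.closure (T : Set ℚ), padicNorm p x ≤ 1 := by
  filter_upwards [T.eventually_all.2 fun x _ => Filter.eventually_gt_atTop x.den] with p hp pp x hx
  have := Fact.mk pp
  induction hx using Subring.closure_induction with
  | mem x hx =>
    have hden : padicNorm p x.den = 1 :=
      (padicNorm.nat_eq_one_iff _).2 fun h => (Nat.le_of_dvd x.pos h).not_gt (hp x hx)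
    rw [← Rat.num_div_den x, padicNorm.div, hden, div_one]
    exact padicNorm.of_int _
  | zero => simp
  | one => simp
  | add x y _ _ hx hy => exact padicNorm.nonarchimedean.trans (max_le hx hy)
  | neg x _ hx => rwa [padicNorm.neg]
  | mul x y _ _ hx hy => rw [padicNorm.mul]; exact mul_le_one₀ hx (padicNorm.nonneg _) hy

end Integrality

/-! ### Unbounded denominators of canonical series -/

section PadicNorm

variable {p : ℕ} [hp : Fact p.Prime]

theorem one_le_padicNorm_invFact {n : ℤ} (hn : -(p : ℤ) ≤ n) : 1 ≤ padicNorm p (invFact n) := by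
  rcases n with n | n
  · have hpos : 0 < padicNorm p (n.factorial : ℚ) :=
      (padicNorm.nonneg _).lt_of_ne' (padicNorm.nonzero (mod_cast n.factorial_ne_zero))
    rw [Int.ofNat_eq_natCast, invFact_natCast, ← one_div, padicNorm.div, padicNorm.one]
    exact one_le_one_div hpos (padicNorm.of_nat _)
  · have hfact : padicNorm p (n.factorial : ℚ) = 1 := by
      rw [padicNorm.nat_eq_one_iff, hp.out.dvd_factorial]
      omega
    rw [invFact_negSucc, padicNorm.mul, hfact, mul_one]
    rcases neg_one_pow_eq_or ℚ (n + 1) with h | h <;> simp [h]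

theorem one_lt_padicNorm_invFact {n : ℤ} (hn : (p : ℤ) ≤ n) : 1 < padicNorm p (invFact n) := by
  lift n to ℕ using by omega
  have hpos : 0 < padicNorm p (n.factorial : ℚ) :=
    (padicNorm.nonneg _).lt_of_ne' (padicNorm.nonzero (mod_cast n.factorial_ne_zero))
  rw [invFact_natCast, ← one_div, padicNorm.div, padicNorm.one]
  refine one_lt_one_div hpos ?_
  rw [padicNorm.nat_lt_one_iff, hp.out.dvd_factorial]
  exact_mod_cast hn

theorem one_lt_padicNorm_invFactProd {u : Fin r → ℤ} (i : Fin r)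
    (hi : (p : ℤ) ≤ u i) (hu : ∀ j, -(p : ℤ) ≤ u j) : 1 < padicNorm p (invFactProd u) := by
  rw [invFactProd, IsAbsoluteValue.map_prod (padicNorm p),
    ← Finset.mul_prod_erase _ _ (Finset.mem_univ i)]
  exact one_lt_mul_of_lt_of_le (one_lt_padicNorm_invFact hi)
    (Finset.prod_induction _ (1 ≤ ·) (fun _ _ => one_le_mul_of_one_le_of_one_le) le_rfl
      fun j _ => one_le_padicNorm_invFact (hu j))

end PadicNorm

theorem eventually_exists_one_lt_padicNorm_invFactProd {u v : Fin r → ℤ} {i : Fin r}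
    (hu : 0 ≤ u i) (hv : 0 < v i) (hlt : ∀ j, -v i < v j) :
    ∀ᶠ p : ℕ in Filter.atTop, p.Prime → ∃ s : ℕ, 1 < padicNorm p (invFactProd (u + s • v)) := by
  filter_upwards [Filter.eventually_all.2 fun j =>
    Filter.eventually_ge_atTop (v i * (v i - u j)).toNat] with p hp pp
  have := Fact.mk pp
  -- The first `s` with `p < s v_i` works: then `p ≤ u_i + s v_i`, while no coordinate of
  -- `u + s v` has dropped below `-p`, because `v_j ≥ 1 - v_i` and `p` is large.
  have hdiv : (p / v i + 1 : ℤ) * v i ≤ p + v i := by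
    linarith [Int.ediv_mul_le (p : ℤ) hv.ne']
  have hdiv_lt : (p : ℤ) < (p / v i + 1) * v i := Int.lt_ediv_add_one_mul_self _ hv
  have hlarge : ∀ j, v i - u j < p / v i + 1 := fun j =>
    Int.lt_add_one_of_le ((Int.le_ediv_iff_mul_le hv).2 (by linarith [Int.toNat_le.1 (hp j)]))
  lift (p / v i + 1 : ℤ) to ℕ using by positivity with s
  refine ⟨s, one_lt_padicNorm_invFactProd i ?_ fun j => ?_⟩ <;>
  rw [Pi.add_apply, Pi.smul_apply, nsmul_eq_mul]
  · linarith
  · have : (s : ℤ) * (1 - v i) ≤ s * v j :=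
      mul_le_mul_of_nonneg_left (by linarith [hlt j]) (Int.natCast_nonneg s)
    linarith [hlarge j]

theorem negSupp_add_nsmul {u v : Fin r → ℤ} (hneg : ∀ j, v j < 0 → u j < 0)
    (hpos : ∀ j, 0 < v j → 0 ≤ u j) (s : ℕ) : negSupp (u + s • v) = negSupp u := by
  ext j
  rw [mem_negSupp, mem_negSupp, Pi.add_apply, Pi.smul_apply, nsmul_eq_mul]
  rcases lt_trichotomy (v j) 0 with h | h | h
  · have := hneg j h
    have := mul_nonpos_of_nonneg_of_nonpos (Int.natCast_nonneg s) h.le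
    lia
  · rw [h, mul_zero, add_zero]
  · have := hpos j h
    have := mul_nonneg (Int.natCast_nonneg s) h.le
    lia

section Exponents

variable {A : Matrix (Fin n) (Fin r) ℤ}

theorem not_isCanonicalSeries {u v : Fin r → ℤ} {i : Fin r} (hA : A.mulVec v = 0) (hi : 0 < v i)
    (hlt : ∀ j, -v i < v j) (hneg : ∀ j, v j < 0 → u j < 0) (hpos : ∀ j, 0 < v j → 0 ≤ u j)
    (φ : RatFun r) : ¬ IsCanonicalSeries A (A.mulVec u) (negSupp u) φ := by
  intro hφ
  classical
  obtain ⟨T, hT⟩ := exists_finset_mem_closure_of_expCoeff_eq (φ := φ)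
    (c := (expClass A (A.mulVec u) (negSupp u)).indicator invFactProd) fun u' => by
      rw [expCoeff_eq_invFactProd_mul_normCoeff, hφ u']
      by_cases hu' : u' ∈ expClass A (A.mulVec u) (negSupp u) <;> simp [hu']
  obtain ⟨p, pp, hle, hlt⟩ :=
    ((Nat.frequently_atTop_iff_infinite.2 Nat.infinite_setOfPred_prime).and_eventually
      ((eventually_padicNorm_le_one_of_mem_closure T).and
        (eventually_exists_one_lt_padicNorm_invFactProd (hpos i hi) hi hlt))).exists
  obtain ⟨s, hs⟩ := hlt pp
  have hmem : u + s • v ∈ expClass A (A.mulVec u) (negSupp u) :=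
    ⟨by rw [Matrix.mulVec_add, Matrix.mulVec_smul, hA, smul_zero, add_zero],
      negSupp_add_nsmul hneg hpos s⟩
  have := hle pp _ (hT (u + s • v))
  rw [Set.indicator_of_mem hmem] at this
  exact this.not_gt hs

theorem IsRationalSolution.exists_neg_and_nonneg {α : Fin n → ℂ} {φ : RatFun r}
    (h : IsRationalSolution A α φ) {u v : Fin r → ℤ} (hu : normCoeff u φ ≠ 0)
    (hA : A.mulVec v = 0) (hv : expDeg v < 0) : ∃ j, v j < 0 ∧ 0 ≤ u j := by
  -- Otherwise all `u + s v` with `s ≥ 0` have nonzero coefficients, and their degrees descend.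
  by_contra! hneg
  have hsub : ∀ s : ℕ, negSupp (u + s • v) ⊆ negSupp u := fun s j hj => by
    rw [mem_negSupp, Pi.add_apply, Pi.smul_apply, nsmul_eq_mul] at hj
    rw [mem_negSupp]
    by_contra! hj0
    have := mul_nonneg (Int.natCast_nonneg s) (not_lt.1 (mt (hneg j) hj0.not_gt))
    lia
  have hne : ∀ s : ℕ, normCoeff (u + s • v) φ ≠ 0 := fun s hs => by
    refine hu ?_
    rw [toric_iff_normCoeff.1 h.toric (u + s • v) u
      (by rw [Matrix.mulVec_add, Matrix.mulVec_smul, hA, smul_zero, add_zero]) (hsub s), hs,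
      ite_self]
  refine Set.isWF_iff_no_descending_seq.1 (expand r φ).isWF_support
    (fun s => expDeg (u + s • v)) (strictAnti_nat_of_succ_lt fun s => ?_) fun s hs => hne s ?_
  · rw [succ_nsmul, ← add_assoc, map_add _ _ v]
    exact add_lt_of_neg_right _ hv
  · rw [normCoeff, LinearMap.smul_apply, expCoeff_apply, hs, smul_zero]

theorem mem_expSemigroup_iff {α : Fin n → ℤ} :
    α ∈ expSemigroup A ↔ ∃ u, A.mulVec u = α ∧ negSupp u = ∅ := by
  constructor
  · rintro ⟨u, hu⟩
    exact ⟨_, hu, negSupp_eq_empty_iff.2 ⟨Finsupp.equivFunOnFinite.symm u, rfl⟩⟩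
  · rintro ⟨u, hu, hs⟩
    obtain ⟨n, rfl⟩ := negSupp_eq_empty_iff.1 hs
    exact ⟨n, hu⟩

end Exponents

/-! ### Exponents of the solutions for a monomial curve -/

section Curve

variable {m : ℕ} {k : Fin (m + 2) → ℕ}

/-- The relation `(k_d - k_i) a_0 + (k_i - k_0) a_d - (k_d - k_0) a_i = 0` between the first, the
last and the `i`-th column of `curveMatrix k`. -/
def curveRelation (k : Fin (m + 2) → ℕ) (i : Fin (m + 2)) : Fin (m + 2) → ℤ :=
  Pi.single 0 (k (Fin.last _) - k i : ℤ) + Pi.single (Fin.last _) (k i - k 0 : ℤ) -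
    Pi.single i (k (Fin.last _) - k 0 : ℤ)

theorem curveMatrix_mulVec_curveRelation (k : Fin (m + 2) → ℕ) (i : Fin (m + 2)) :
    (curveMatrix k).mulVec (curveRelation k i) = 0 := by
  ext j
  rw [curveRelation, Matrix.mulVec_sub, Matrix.mulVec_add]
  fin_cases j
  · simp [curveMatrix]
  · simp [curveMatrix]
    ring

theorem curveRelation_nonneg (hk : Monotone k) {i j : Fin (m + 2)} (hj : j ≠ i) :
    0 ≤ curveRelation k i j := by
  have h0 : (k 0 : ℤ) ≤ k i := mod_cast hk (Fin.zero_le i)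
  have hl : (k i : ℤ) ≤ k (Fin.last _) := mod_cast hk (Fin.le_last i)
  rw [curveRelation, Pi.sub_apply, Pi.single_eq_of_ne hj, sub_zero]
  exact add_nonneg (Pi.single_nonneg (α := fun _ => ℤ).2 (sub_nonneg.2 hl) j)
    (Pi.single_nonneg (α := fun _ => ℤ).2 (sub_nonneg.2 h0) j)

theorem curveRelation_zero {i : Fin (m + 2)} (hi : i ≠ 0) :
    curveRelation k i 0 = k (Fin.last _) - k i := by
  simp [curveRelation, hi.symm, Fin.last_pos.ne]

theorem curveRelation_last {i : Fin (m + 2)} (hi : i ≠ Fin.last _) :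
    curveRelation k i (Fin.last _) = k i - k 0 := by
  simp [curveRelation, hi.symm, Fin.last_pos.ne']

theorem curveRelation_self {i : Fin (m + 2)} (h0 : i ≠ 0) (hl : i ≠ Fin.last _) :
    curveRelation k i i = -(k (Fin.last _) - k 0) := by
  simp [curveRelation, h0, hl]

theorem curveRelation_of_ne {i j : Fin (m + 2)} (hj : j ≠ i) (h0 : j ≠ 0) (hl : j ≠ Fin.last _) :
    curveRelation k i j = 0 := by
  simp [curveRelation, hj, h0, hl]

theorem curveRelation_lt (hk : StrictMono k) {i : Fin (m + 2)} (h0 : i ≠ 0)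
    (hl : i ≠ Fin.last _) (j : Fin (m + 2)) :
    curveRelation k i j < k (Fin.last _) - k 0 := by
  have hi0 := hk (Fin.pos_of_ne_zero h0)
  have hil := hk (Fin.lt_last_iff_ne_last.2 hl)
  obtain rfl | hj0 := eq_or_ne j 0
  · rw [curveRelation_zero h0]
    omega
  obtain rfl | hjl := eq_or_ne j (Fin.last _)
  · rw [curveRelation_last hl]
    omega
  obtain rfl | hji := eq_or_ne j i
  · rw [curveRelation_self h0 hl]
    omega
  · rw [curveRelation_of_ne hji hj0 hjl]
    omega

theorem expDeg_curveRelation_neg (hk : StrictMono k) {i : Fin (m + 2)} (h0 : i ≠ 0)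
    (hl : i ≠ Fin.last _) : expDeg (curveRelation k i) < 0 := by
  refine ⟨0, fun j hj => absurd hj (Fin.not_lt_zero j), ?_⟩
  have h : k i < k (Fin.last _) := hk (Fin.lt_last_iff_ne_last.2 hl)
  change -curveRelation k i 0 < 0
  rw [curveRelation_zero h0]
  omega

variable {α : Fin 2 → ℤ} {φ : RatFun (m + 2)} {u : Fin (m + 2) → ℤ}

theorem IsRationalSolution.negSupp_subset (hk : StrictMono k)
    (h : IsRationalSolution (curveMatrix k) (fun i => (α i : ℂ)) φ) (hu : normCoeff u φ ≠ 0) :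
    negSupp u ⊆ {0, Fin.last _} := by
  intro i hi
  rw [Finset.mem_insert, Finset.mem_singleton]
  by_contra! hne
  obtain ⟨j, hj, hj0⟩ := h.exists_neg_and_nonneg hu (curveMatrix_mulVec_curveRelation k i)
    (expDeg_curveRelation_neg hk hne.1 hne.2)
  obtain rfl : j = i := by
    by_contra hji
    exact hj.not_ge (curveRelation_nonneg hk.monotone hji)
  exact hj0.not_gt (mem_negSupp.1 hi)

theorem IsRationalSolution.negSupp_ne (hm : 1 ≤ m) (hk : StrictMono k)
    (h : IsRationalSolution (curveMatrix k) (fun i => (α i : ℂ)) φ) (hu : normCoeff u φ ≠ 0) :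
    negSupp u ≠ {0, Fin.last _} := by
  intro hs
  have h0 : (1 : Fin (m + 2)) ≠ 0 := one_ne_zero
  have hl : (1 : Fin (m + 2)) ≠ Fin.last _ := by
    rw [Ne, Fin.ext_iff, Fin.val_last, Fin.val_one]
    omega
  have hcanon := h.isCanonicalSeries_inv_smul hu fun u' hu' => hs ▸ h.negSupp_subset hk hu'
  rw [← h.mulVec_eq hu] at hcanon
  have hself := curveRelation_self (k := k) h0 hl
  refine not_isCanonicalSeries (v := -curveRelation k 1) (i := 1)
    (by rw [Matrix.mulVec_neg, curveMatrix_mulVec_curveRelation, neg_zero])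
    ?_ (fun j => ?_) (fun j hj => ?_) (fun j hj => ?_) _ hcanon
  · rw [Pi.neg_apply, hself, neg_neg, sub_pos, Nat.cast_lt]
    exact hk Fin.last_pos
  · rw [Pi.neg_apply, Pi.neg_apply, neg_lt_neg_iff, hself, neg_neg]
    exact curveRelation_lt hk h0 hl j
  · rw [Pi.neg_apply, neg_lt_zero] at hj
    rw [← mem_negSupp, hs, Finset.mem_insert, Finset.mem_singleton]
    by_contra! hne
    obtain rfl | hj1 := eq_or_ne j 1
    · have := hk (Fin.last_pos (n := m))
      omega
    · exact hj.ne' (curveRelation_of_ne hj1 hne.1 hne.2)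
  · rw [Pi.neg_apply, neg_pos] at hj
    obtain rfl : j = 1 := by
      by_contra hj1
      exact hj.not_ge (curveRelation_nonneg hk.monotone hj1)
    rw [← not_lt, ← mem_negSupp, hs]
    simp [h0, hl]

end Curve

open MvPolynomial

/-! ### The Laurent polynomials `Φ` and `Ψ` -/

theorem coeff_hypPoly {A : Matrix (Fin n) (Fin r) ℤ} {α : Fin n → ℤ}
    (hfin : {u : Fin r →₀ ℕ | A.mulVec (fun j => (u j : ℤ)) = α}.Finite) (u : Fin r →₀ ℕ) :
    (hypPoly A α).coeff u =
      if A.mulVec (intExp u) = α then (invFactProd (intExp u) : ℂ) else 0 := by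
  classical
  have hprod : (invFactProd (intExp u) : ℂ) = (∏ j, ((u j).factorial : ℂ))⁻¹ := by
    simp [invFactProd, intExp, invFact_natCast]
  have hsum : hypPoly A α = ∑ u ∈ hfin.toFinset, monomial u (∏ j, ((u j).factorial : ℂ))⁻¹ :=
    finsum_mem_eq_finite_toFinset_sum _ hfin
  rw [hsum, coeff_sum, hprod]
  simp only [coeff_monomial, Finset.sum_ite_eq', Set.Finite.mem_toFinset]
  rfl

theorem isCanonicalSeries_hypPoly {A : Matrix (Fin n) (Fin r) ℤ} {α : Fin n → ℤ}
    (hfin : {u : Fin r →₀ ℕ | A.mulVec (fun j => (u j : ℤ)) = α}.Finite) :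
    IsCanonicalSeries A α ∅ (ofPoly (hypPoly A α)) := by
  intro u
  by_cases hu : negSupp u = ∅
  · obtain ⟨l, rfl⟩ := negSupp_eq_empty_iff.1 hu
    have hne : (invFactProd (intExp l) : ℂ) ≠ 0 := Rat.cast_ne_zero.2 (invFactProd_ne_zero _)
    rw [normCoeff, LinearMap.smul_apply, expCoeff_ofPoly_intExp, coeff_hypPoly hfin]
    by_cases hA : A.mulVec (intExp l) = α
    · have hmem : intExp l ∈ expClass A α ∅ := ⟨hA, hu⟩
      rw [if_pos hA, Set.indicator_of_mem hmem, smul_eq_mul, inv_mul_cancel₀ hne]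
      rfl
    · rw [if_neg hA, Set.indicator_of_notMem fun h => hA h.1, smul_zero]
  · rw [normCoeff_ofPoly_eq_zero _ hu, Set.indicator_of_notMem fun h => hu h.2]

theorem var_ne_zero (j : Fin r) : (var j : RatFun r) ≠ 0 :=
  (map_ne_zero_iff _ (IsFractionRing.injective _ _)).2 (X_ne_zero j)

theorem expCoeff_ofPoly_monomial (u : Fin r → ℤ) (l : Fin r →₀ ℕ) (c : ℂ) :
    expCoeff u (ofPoly (monomial l c)) = open Classical in if u = intExp l then c else 0 := by
  rw [expCoeff_apply, expand_ofPoly, polyExpand_monomial, HahnSeries.coeff_single]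
  simp only [expDeg.injective.eq_iff]

theorem expCoeff_div_var_pow (j : Fin r) (φ : RatFun r) (s : ℕ) (u : Fin r → ℤ) :
    expCoeff u (φ / var j ^ s) = expCoeff (u + Pi.single j (s : ℤ)) φ := by
  induction s generalizing u with
  | zero => simp
  | succ s ih =>
    have h := expCoeff_var_mul j (φ / var j ^ (s + 1)) (u + Pi.single j 1)
    rw [add_sub_cancel_right, pow_succ, ← div_div, mul_div_cancel₀ _ (var_ne_zero j), ih,
      add_assoc, ← Pi.single_add] at h
    rw [pow_succ, ← div_div, ← h, Nat.cast_succ, add_comm (1 : ℤ)]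

theorem expCoeff_ofPoly_rename_succAbove (i : Fin (r + 1)) (P : MvPolynomial (Fin r) ℂ)
    (u : Fin (r + 1) → ℤ) :
    expCoeff u (ofPoly (rename i.succAbove P)) =
      if u i = 0 then expCoeff (u ∘ i.succAbove) (ofPoly P) else 0 := by
  classical
  induction P using MvPolynomial.induction_on' with
  | monomial l c =>
    rw [rename_monomial, expCoeff_ofPoly_monomial, expCoeff_ofPoly_monomial, ← ite_and]
    refine if_congr ?_ rfl rfl
    rw [funext_iff, Fin.forall_iff_succAbove i, funext_iff]
    refine and_congr ?_ (forall_congr' fun j => ?_)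
    · have hi : Finsupp.mapDomain i.succAbove l i = 0 :=
        Finsupp.mapDomain_of_notMem_range _ _ fun ⟨j, hj⟩ => Fin.succAbove_ne i j hj
      change u i = (Finsupp.mapDomain i.succAbove l i : ℤ) ↔ _
      rw [hi, Nat.cast_zero]
    · change u _ = (Finsupp.mapDomain i.succAbove l _ : ℤ) ↔ _
      rw [Finsupp.mapDomain_apply Fin.succAbove_right_injective]
      rfl
  | add p q hp hq =>
    simp only [map_add, hp, hq]
    split_ifs
    · rfl
    · rw [add_zero]

theorem negSupp_eq_singleton_iff {i : Fin (r + 1)} {u : Fin (r + 1) → ℤ} :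
    negSupp u = {i} ↔ u i < 0 ∧ negSupp (u ∘ i.succAbove) = ∅ := by
  rw [Finset.ext_iff, Fin.forall_iff_succAbove i, Finset.eq_empty_iff_forall_notMem]
  simp [mem_negSupp]

theorem submatrix_succAbove_mulVec (A : Matrix (Fin n) (Fin (r + 1)) ℤ) (i : Fin (r + 1))
    (u : Fin (r + 1) → ℤ) :
    (A.submatrix id i.succAbove).mulVec (u ∘ i.succAbove) = A.mulVec u - u i • A.col i := by
  ext l
  simp only [Matrix.mulVec, dotProduct, Pi.sub_apply, Pi.smul_apply, Fin.sum_univ_succAbove _ i,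
    Matrix.submatrix_apply, id, Function.comp_apply, smul_eq_mul, Matrix.col_apply]
  ring

/-- The `s`-th term of `psiZero` and `psiLast`, for an arbitrary variable `x_i` in the
denominator. -/
def psiTerm (i : Fin (r + 1)) (A : Matrix (Fin n) (Fin (r + 1)) ℤ) (α : Fin n → ℤ) (s : ℕ) :
    RatFun (r + 1) :=
  ((-1) ^ s * ((s - 1).factorial : ℂ)) • (ofPoly (rename i.succAbove
    (hypPoly (A.submatrix id i.succAbove) (α + (s : ℤ) • A.col i))) / var i ^ s)

/-- The common generalization of `psiZero` and `psiLast` to an arbitrary variable `x_i`. -/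
def psiAt (i : Fin (r + 1)) (A : Matrix (Fin n) (Fin (r + 1)) ℤ) (α : Fin n → ℤ) :
    RatFun (r + 1) :=
  ∑ᶠ (s : ℕ) (_ : 1 ≤ s), psiTerm i A α s

theorem psiLast_eq_psiAt (A : Matrix (Fin n) (Fin (r + 1)) ℤ) (α : Fin n → ℤ) :
    psiLast A α = psiAt (Fin.last r) A α := by
  simp only [psiLast, psiAt, psiTerm, Fin.succAbove_last]
  rfl

theorem psiZero_eq_psiAt (A : Matrix (Fin n) (Fin (r + 1)) ℤ) (α : Fin n → ℤ) :
    psiZero A α = psiAt 0 A α := by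
  simp only [psiZero, psiAt, psiTerm, Fin.succAbove_zero]
  rfl

section Psi

variable {i : Fin (r + 1)} {A : Matrix (Fin n) (Fin (r + 1)) ℤ} {α : Fin n → ℤ}

theorem mem_expClass_singleton_iff {u : Fin (r + 1) → ℤ} {s : ℕ} (hs : 1 ≤ s) (hu : u i = -s) :
    u ∈ expClass A α {i} ↔
      u ∘ i.succAbove ∈ expClass (A.submatrix id i.succAbove) (α + (s : ℤ) • A.col i) ∅ := by
  refine and_congr ?_ ?_
  · rw [submatrix_succAbove_mulVec, hu, neg_smul, sub_neg_eq_add, add_left_inj]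
  · rw [negSupp_eq_singleton_iff, and_iff_right (by omega)]

theorem normCoeff_psiTerm {s : ℕ} (hs : 1 ≤ s)
    (hfin : {u : Fin r →₀ ℕ | (A.submatrix id i.succAbove).mulVec (fun j => (u j : ℤ)) =
      α + (s : ℤ) • A.col i}.Finite) (u : Fin (r + 1) → ℤ) :
    normCoeff u (psiTerm i A α s) =
      if u i = -s then (expClass A α {i}).indicator 1 u else 0 := by
  have hcomp : (u + Pi.single i (s : ℤ)) ∘ i.succAbove = u ∘ i.succAbove := by
    ext j
    simp [Fin.succAbove_ne]
  have hi : (u + Pi.single i (s : ℤ) : Fin (r + 1) → ℤ) i = 0 ↔ u i = -s := by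
    simp [add_eq_zero_iff_eq_neg]
  rw [normCoeff, LinearMap.smul_apply, psiTerm, map_smul, expCoeff_div_var_pow,
    expCoeff_ofPoly_rename_succAbove, hcomp]
  simp only [hi]
  split_ifs with hu
  · have hγ : (invFactProd u : ℂ) =
        (-1) ^ s * ((s - 1).factorial : ℂ) * invFactProd (u ∘ i.succAbove) := by
      have : u i = Int.negSucc (s - 1) := by omega
      rw [invFactProd, Fin.prod_univ_succAbove _ i, this, invFact_negSucc, Nat.sub_add_cancel hs]
      push_cast [invFactProd]
      rfl
    have hne : (invFactProd u : ℂ) ≠ 0 := Rat.cast_ne_zero.2 (invFactProd_ne_zero u)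
    rw [expCoeff_eq_invFactProd_mul_normCoeff, isCanonicalSeries_hypPoly hfin, smul_smul,
      smul_eq_mul, ← mul_assoc, mul_assoc _ (_ * _) (_ : ℂ), ← hγ, inv_mul_cancel₀ hne, one_mul]
    exact Set.indicator_const_eq_indicator_const (mem_expClass_singleton_iff hs hu).symm
  · rw [smul_zero, smul_zero]

theorem isCanonicalSeries_psiAt
    (hfin : ∀ β, {u : Fin r →₀ ℕ | (A.submatrix id i.succAbove).mulVec (fun j => (u j : ℤ)) =
      β}.Finite)
    (hs : {s : ℕ | hypPoly (A.submatrix id i.succAbove) (α + (s : ℤ) • A.col i) ≠ 0}.Finite) :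
    IsCanonicalSeries A α {i} (psiAt i A α) := by
  intro u
  have hsum : normCoeff u (psiAt i A α) =
      ∑ᶠ s ∈ {s : ℕ | 1 ≤ s}, normCoeff u (psiTerm i A α s) :=
    (normCoeff u).toAddMonoidHom.map_finsum_mem' (hs.subset fun s hs' h0 => hs'.2 (by
      rw [psiTerm, h0, map_zero, ofPoly, map_zero, zero_div, smul_zero]))
  rw [hsum, finsum_mem_congr rfl fun s (hs : s ∈ {s : ℕ | 1 ≤ s}) =>
    normCoeff_psiTerm hs (hfin _) u]
  by_cases hu : u i < 0
  · obtain ⟨s, hs⟩ : ∃ s : ℕ, u i = -s := ⟨(u i).natAbs, by omega⟩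
    rw [finsum_eq_single _ s, finsum_eq_if, if_pos (by rw [Set.mem_ofPred_eq]; omega), if_pos hs]
    intro s' hs'
    rw [if_neg (by omega), finsum_eq_if, ite_self]
  · rw [Set.indicator_of_notMem fun h => hu (negSupp_eq_singleton_iff.1 h.2).1]
    simp

theorem finite_setOf_hypPoly_ne_zero (l : Fin n → ℤ)
    (hnonneg : ∀ j, 0 ≤ Matrix.vecMul l A (i.succAbove j)) (hneg : Matrix.vecMul l A i < 0) :
    {s : ℕ | hypPoly (A.submatrix id i.succAbove) (α + (s : ℤ) • A.col i) ≠ 0}.Finite := by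
  refine (Set.finite_Iic (l ⬝ᵥ α).toNat).subset fun s hs => ?_
  obtain ⟨u, hu⟩ := mem_of_hypPoly_ne_zero hs
  have hdot : 0 ≤ l ⬝ᵥ (α + (s : ℤ) • A.col i) := by
    rw [← hu, Matrix.dotProduct_mulVec]
    exact Finset.sum_nonneg fun j _ => mul_nonneg (hnonneg j) (Int.natCast_nonneg _)
  rw [dotProduct_add, dotProduct_smul, smul_eq_mul] at hdot
  have hcol : l ⬝ᵥ A.col i < 0 := hneg
  have : (s : ℤ) * (l ⬝ᵥ A.col i) ≤ s * (-1) :=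
    mul_le_mul_of_nonneg_left (by omega) (Int.natCast_nonneg s)
  rw [Set.mem_Iic]
  omega

end Psi

section Curve

variable {k : Fin (r + 1) → ℕ}

theorem hypPoly_submatrix_finite {q : ℕ} (k : Fin r → ℕ) (f : Fin q → Fin r) (α : Fin 2 → ℤ) :
    {u : Fin q →₀ ℕ | ((curveMatrix k).submatrix id f).mulVec (fun j => (u j : ℤ)) = α}.Finite := by
  have h : (curveMatrix k).submatrix id f = curveMatrix (k ∘ f) := by
    ext i j
    fin_cases i <;> rfl
  rw [h]
  exact hypPoly_finite _ _

theorem vecMul_curveMatrix (k : Fin r → ℕ) (a b : ℤ) (j : Fin r) :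
    Matrix.vecMul ![a, b] (curveMatrix k) j = a + b * k j := by
  simp [curveMatrix, Matrix.vecMul, dotProduct]

theorem isCanonicalSeries_psiZero (hk : StrictMono k) (α : Fin 2 → ℤ) :
    IsCanonicalSeries (curveMatrix k) α {0} (psiZero (curveMatrix k) α) := by
  rw [psiZero_eq_psiAt]
  refine isCanonicalSeries_psiAt (hypPoly_submatrix_finite k _)
    (finite_setOf_hypPoly_ne_zero ![-k 0 - 1, 1] (fun j => ?_) ?_) <;> rw [vecMul_curveMatrix]
  · have : k 0 < k (Fin.succAbove 0 j) := hk (Fin.succ_pos j)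
    omega
  · omega

theorem isCanonicalSeries_psiLast (hk : StrictMono k) (α : Fin 2 → ℤ) :
    IsCanonicalSeries (curveMatrix k) α {Fin.last r} (psiLast (curveMatrix k) α) := by
  rw [psiLast_eq_psiAt]
  refine isCanonicalSeries_psiAt (hypPoly_submatrix_finite k _)
    (finite_setOf_hypPoly_ne_zero ![k (Fin.last r) - 1, -1] (fun j => ?_) ?_) <;>
    rw [vecMul_curveMatrix]
  · have : k (Fin.succAbove (Fin.last r) j) < k (Fin.last r) :=
      hk (Fin.lt_last_iff_ne_last.2 (Fin.succAbove_ne _ j))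
    omega
  · omega

end Curve

/-! ### Denominators -/

section Denominators

theorem exists_mem_den_dvd_of_mem_ofField {R K : Type*} [CommRing R] [IsDomain R]
    [UniqueFactorizationMonoid R] [Field K] [Algebra R K] [IsFractionRing R K] {S : Submonoid R}
    {hS : S ≤ nonZeroDivisors R} {φ : K} (h : φ ∈ Localization.subalgebra.ofField K S hS) :
    ∃ s ∈ S, (IsFractionRing.den R φ : R) ∣ s := by
  obtain ⟨P, s, hs, rfl⟩ := h
  set φ := algebraMap R K P * (algebraMap R K s)⁻¹
  refine ⟨s, hs, (IsFractionRing.num_den_reduced R φ).symm.dvd_of_dvd_mul_left ⟨P, ?_⟩⟩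
  have hs0 : algebraMap R K s ≠ 0 := IsFractionRing.to_map_ne_zero_of_mem_nonZeroDivisors (hS hs)
  have hden : algebraMap R K (IsFractionRing.den R φ) ≠ 0 :=
    IsFractionRing.to_map_ne_zero_of_mem_nonZeroDivisors (IsFractionRing.den R φ).2
  have hφ := IsFractionRing.mk'_num_den' R φ
  rw [div_eq_iff hden] at hφ
  apply IsFractionRing.injective R K
  rw [map_mul, map_mul, hφ, mul_right_comm, inv_mul_cancel_right₀ hs0, mul_comm]

theorem ofPoly_monomial (l : Fin r →₀ ℕ) (c : ℂ) :
    ofPoly (monomial l c) = c • ∏ j, var j ^ intExp l j := by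
  rw [monomial_eq, Finsupp.prod_fintype _ _ (fun _ => pow_zero _), ofPoly, map_mul, map_prod,
    Algebra.smul_def]
  simp only [map_pow, intExp]
  rfl

theorem ofPoly_div_monomial_mem_laurentPolynomials (P : MvPolynomial (Fin r) ℂ) (l : Fin r →₀ ℕ) :
    ofPoly P / ofPoly (monomial l 1) ∈ laurentPolynomials r := by
  induction P using MvPolynomial.induction_on' with
  | monomial l' c =>
    rw [ofPoly_monomial, ofPoly_monomial, one_smul, smul_div_assoc, ← Finset.prod_div_distrib]
    refine Submodule.smul_mem _ c (Submodule.subset_span ⟨intExp l' - intExp l, ?_⟩)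
    exact Finset.prod_congr rfl fun j _ => zpow_sub₀ (var_ne_zero j) _ _
  | add P Q hP hQ =>
    rw [ofPoly, map_add, add_div]
    exact Submodule.add_mem _ hP hQ

theorem closure_X_pair_le_nonZeroDivisors (i j : Fin r) :
    Submonoid.closure {X i, X j} ≤ nonZeroDivisors (MvPolynomial (Fin r) ℂ) := by
  simp [Submonoid.closure_le, Set.pair_subset_iff, X_ne_zero]

/-- The algebra of the rational functions whose denominator is a monomial in `x_i` and `x_j`. -/
def monomialDenom (i j : Fin r) : Subalgebra (MvPolynomial (Fin r) ℂ) (RatFun r) :=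
  Localization.subalgebra.ofField (RatFun r) (Submonoid.closure {X i, X j})
    (closure_X_pair_le_nonZeroDivisors i j)

variable {i j : Fin r} {φ : RatFun r}

theorem exists_den_dvd_of_mem_monomialDenom (h : φ ∈ monomialDenom i j) :
    ∃ a b : ℕ, (IsFractionRing.den (MvPolynomial (Fin r) ℂ) φ : MvPolynomial (Fin r) ℂ) ∣
      X i ^ a * X j ^ b := by
  obtain ⟨s, hs, hdvd⟩ := exists_mem_den_dvd_of_mem_ofField h
  obtain ⟨a, b, rfl⟩ := (Submonoid.mem_closure_pair _ _ _).1 hs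
  exact ⟨a, b, hdvd⟩

theorem mem_laurentPolynomials_of_mem_monomialDenom (h : φ ∈ monomialDenom i j) :
    φ ∈ laurentPolynomials r := by
  obtain ⟨P, s, hs, rfl⟩ := h
  obtain ⟨a, b, rfl⟩ := (Submonoid.mem_closure_pair _ _ _).1 hs
  rw [← div_eq_mul_inv, X_pow_eq_monomial, X_pow_eq_monomial, monomial_mul, one_mul]
  exact ofPoly_div_monomial_mem_laurentPolynomials P _

theorem smul_mem_monomialDenom (c : ℂ) (h : φ ∈ monomialDenom i j) : c • φ ∈ monomialDenom i j :=
  ((monomialDenom i j).restrictScalars ℂ).smul_mem h c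

theorem ofPoly_div_var_pow_mem_monomialDenom {l : Fin r} (hl : l = i ∨ l = j)
    (P : MvPolynomial (Fin r) ℂ) (s : ℕ) : ofPoly P / var l ^ s ∈ monomialDenom i j := by
  have hX : (X l : MvPolynomial (Fin r) ℂ) ∈ Submonoid.closure {X i, X j} :=
    Submonoid.subset_closure (by rcases hl with rfl | rfl <;> simp)
  exact ⟨P, X l ^ s, pow_mem hX s, by rw [div_eq_mul_inv, map_pow]⟩

theorem psiAt_mem_monomialDenom {l i j : Fin (r + 1)} (hl : l = i ∨ l = j)
    (A : Matrix (Fin n) (Fin (r + 1)) ℤ) (α : Fin n → ℤ) :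
    psiAt l A α ∈ monomialDenom i j :=
  finsum_mem_induction (· ∈ monomialDenom i j) (zero_mem _) (fun _ _ => add_mem) fun _ _ =>
    smul_mem_monomialDenom _ (ofPoly_div_var_pow_mem_monomialDenom hl _ _)

end Denominators

/-! ### Classification of the rational solutions -/

theorem isRationalSolution_iff_exists_eq_smul_hypPoly {A : Matrix (Fin n) (Fin r) ℤ}
    {α : Fin n → ℤ} {φ : RatFun r}
    (hfin : {u : Fin r →₀ ℕ | A.mulVec (fun j => (u j : ℤ)) = α}.Finite)
    (hα : α ∈ expSemigroup A) :
    IsRationalSolution A (fun i => (α i : ℂ)) φ ↔ ∃ c : ℂ, φ = c • ofPoly (hypPoly A α) := by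
  have hcanon := isCanonicalSeries_hypPoly hfin
  constructor
  · intro h
    obtain ⟨u₀, hu₀, hs₀⟩ := mem_expSemigroup_iff.1 hα
    obtain ⟨c, hc⟩ := h.exists_eq_sum_smul (s := {()}) (fun _ _ => hcanon)
      (Set.injOn_of_injective (Function.injective_of_subsingleton _)) fun u hu => ⟨(), by simp, by
        rw [← h.negSupp_eq_of_subset hu₀ hu (hs₀ ▸ Finset.empty_subset _), hs₀]⟩
    exact ⟨c (), by rw [hc, Finset.sum_singleton]⟩
  · rintro ⟨c, rfl⟩
    exact (hcanon.isRationalSolution fun u _ => Finset.subset_empty.1).smul c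

theorem IsCanonicalSeries.isRationalSolution_of_notMem_expSemigroup {A : Matrix (Fin n) (Fin r) ℤ}
    {α : Fin n → ℤ} {φ : RatFun r} {i : Fin r} (hφ : IsCanonicalSeries A α {i} φ)
    (hα : α ∉ expSemigroup A) : IsRationalSolution A (fun i => (α i : ℂ)) φ :=
  hφ.isRationalSolution fun u hu hs => (Finset.subset_singleton_iff.1 hs).resolve_left fun h =>
    hα (mem_expSemigroup_iff.2 ⟨u, hu, h⟩)

section Curve

variable {m : ℕ} {k : Fin (m + 2) → ℕ} {φ : RatFun (m + 2)}

theorem IsRationalSolution.negSupp_eq_zero_or_last (hm : 1 ≤ m) (hk : StrictMono k)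
    {α : Fin 2 → ℤ} (h : IsRationalSolution (curveMatrix k) (fun i => (α i : ℂ)) φ)
    (hα : α ∉ expSemigroup (curveMatrix k)) {u : Fin (m + 2) → ℤ} (hu : normCoeff u φ ≠ 0) :
    negSupp u = {0} ∨ negSupp u = {Fin.last _} := by
  have hsub := h.negSupp_subset hk hu
  rw [← Finset.coe_subset, Finset.coe_pair, Set.subset_pair_iff_eq] at hsub
  norm_cast at hsub
  have hempty : negSupp u ≠ ∅ := fun he => hα (mem_expSemigroup_iff.2 ⟨u, h.mulVec_eq hu, he⟩)
  have hpair := h.negSupp_ne hm hk hu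
  tauto

theorem isRationalSolution_iff_exists_eq_smul_psi (hm : 1 ≤ m) (hk : StrictMono k)
    {α : Fin 2 → ℤ} (hα : α ∉ expSemigroup (curveMatrix k)) :
    IsRationalSolution (curveMatrix k) (fun i => (α i : ℂ)) φ ↔
      ∃ c₀ c_d : ℂ, φ = c₀ • psiZero (curveMatrix k) α + c_d • psiLast (curveMatrix k) α := by
  have hzero := isCanonicalSeries_psiZero hk α
  have hlast := isCanonicalSeries_psiLast hk α
  constructor
  · intro h
    rw [psiZero_eq_psiAt] at hzero ⊢
    rw [psiLast_eq_psiAt] at hlast ⊢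
    obtain ⟨c, hc⟩ := h.exists_eq_sum_smul (s := {0, Fin.last _}) (I := fun i => {i})
      (ψ := fun i => psiAt i (curveMatrix k) α) (by simp [hzero, hlast])
      Finset.singleton_injective.injOn
      fun u hu => by simpa using h.negSupp_eq_zero_or_last hm hk hα hu
    exact ⟨c 0, c (Fin.last _), by rw [hc, Finset.sum_pair Fin.last_pos.ne]⟩
  · rintro ⟨c₀, c_d, rfl⟩
    exact ((hzero.isRationalSolution_of_notMem_expSemigroup hα).smul c₀).add
      ((hlast.isRationalSolution_of_notMem_expSemigroup hα).smul c_d)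

theorem IsRationalSolution.mem_monomialDenom (hm : 1 ≤ m) (hk : StrictMono k) {α : Fin 2 → ℂ}
    (h : IsRationalSolution (curveMatrix k) α φ) : φ ∈ monomialDenom 0 (Fin.last (m + 1)) := by
  by_cases hα_int : ∃ a : Fin 2 → ℤ, α = fun i => (a i : ℂ)
  · obtain ⟨α, rfl⟩ := hα_int
    by_cases hα : α ∈ expSemigroup (curveMatrix k)
    · obtain ⟨c, rfl⟩ := (isRationalSolution_iff_exists_eq_smul_hypPoly (hypPoly_finite k α) hα).1 h
      exact smul_mem_monomialDenom c (Subalgebra.algebraMap_mem _ _)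
    · obtain ⟨c₀, c_d, rfl⟩ := (isRationalSolution_iff_exists_eq_smul_psi hm hk hα).1 h
      rw [psiZero_eq_psiAt, psiLast_eq_psiAt]
      exact add_mem (smul_mem_monomialDenom _ (psiAt_mem_monomialDenom (.inl rfl) _ _))
        (smul_mem_monomialDenom _ (psiAt_mem_monomialDenom (.inr rfl) _ _))
  · rw [(isRationalSolution_iff_eq_zero hα_int).1 h]
    exact zero_mem _

end Curve

theorem associated_X_of_dvd_X_pow_mul_X_pow {p : MvPolynomial (Fin r) ℂ} (hp : Irreducible p)
    {i j : Fin r} {a b : ℕ} (h : p ∣ X i ^ a * X j ^ b) :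
    Associated p (X i) ∨ Associated p (X j) :=
  (hp.prime.dvd_or_dvd h).imp
    (fun hi => hp.associated_of_dvd (X_prime (i := i)).irreducible (hp.prime.dvd_of_dvd_pow hi))
    (fun hj => hp.associated_of_dvd (X_prime (i := j)).irreducible (hp.prime.dvd_of_dvd_pow hj))

end GKZ

end

theorem theorem1p10_general (m : ℕ) (hm : 1 ≤ m) (k : Fin (m + 2) → ℕ) (hk : StrictMono k) :
    (∀ (α : Fin 2 → ℂ) (φ : GKZ.RatFun (m + 2)),
      GKZ.IsRationalSolution (GKZ.curveMatrix k) α φ →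
        φ ∈ GKZ.laurentPolynomials (m + 2) ∧
        (∃ a b : ℕ, (IsFractionRing.den (MvPolynomial (Fin (m + 2)) ℂ) φ :
            MvPolynomial (Fin (m + 2)) ℂ) ∣
          MvPolynomial.X 0 ^ a * MvPolynomial.X (Fin.last (m + 1)) ^ b) ∧
        ∀ p : MvPolynomial (Fin (m + 2)) ℂ, Irreducible p →
          p ∣ (IsFractionRing.den (MvPolynomial (Fin (m + 2)) ℂ) φ :
            MvPolynomial (Fin (m + 2)) ℂ) →
          Associated p (MvPolynomial.X 0) ∨ Associated p (MvPolynomial.X (Fin.last (m + 1)))) ∧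
    (∀ α : Fin 2 → ℂ, (¬ ∃ a : Fin 2 → ℤ, α = fun i => (a i : ℂ)) →
      ∀ φ : GKZ.RatFun (m + 2),
        GKZ.IsRationalSolution (GKZ.curveMatrix k) α φ ↔ φ = 0) ∧
    (∀ α : Fin 2 → ℤ, α ∈ GKZ.expSemigroup (GKZ.curveMatrix k) →
      ∀ φ : GKZ.RatFun (m + 2),
        GKZ.IsRationalSolution (GKZ.curveMatrix k) (fun i => (α i : ℂ)) φ ↔
          ∃ c : ℂ, φ = c • GKZ.ofPoly (GKZ.hypPoly (GKZ.curveMatrix k) α)) ∧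
    (∀ α : Fin 2 → ℤ, α ∉ GKZ.expSemigroup (GKZ.curveMatrix k) →
      ∀ φ : GKZ.RatFun (m + 2),
        GKZ.IsRationalSolution (GKZ.curveMatrix k) (fun i => (α i : ℂ)) φ ↔
          ∃ c₀ c_d : ℂ, φ = c₀ • GKZ.psiZero (GKZ.curveMatrix k) α +
            c_d • GKZ.psiLast (GKZ.curveMatrix k) α) := by
  refine ⟨fun α φ h => ?_, fun α hα φ => GKZ.isRationalSolution_iff_eq_zero hα,
    fun α hα φ => GKZ.isRationalSolution_iff_exists_eq_smul_hypPoly (GKZ.hypPoly_finite k α) hα,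
    fun α hα φ => GKZ.isRationalSolution_iff_exists_eq_smul_psi hm hk hα⟩
  have hmem := h.mem_monomialDenom hm hk
  obtain ⟨a, b, hdvd⟩ := GKZ.exists_den_dvd_of_mem_monomialDenom hmem
  exact ⟨GKZ.mem_laurentPolynomials_of_mem_monomialDenom hmem, ⟨a, b, hdvd⟩,
    fun p hp hpden => GKZ.associated_X_of_dvd_X_pow_mul_X_pow hp (hpden.trans hdvd)⟩

theorem theorem1p10 (m : ℕ) (hm : 1 ≤ m) (k : Fin (m + 2) → ℕ) (hk : StrictMono k)
    (hk0 : k 0 = 0) :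
    -- every rational solution is a Laurent polynomial; its denominator is a divisor of a monomial
    -- in the first and the last variable, and has no irreducible factor in common with the
    -- discriminant of the generic polynomial, other than these two variables
    (∀ (α : Fin 2 → ℂ) (φ : GKZ.RatFun (m + 2)),
      GKZ.IsRationalSolution (GKZ.curveMatrix k) α φ →
        φ ∈ GKZ.laurentPolynomials (m + 2) ∧
        (∃ a b : ℕ, (IsFractionRing.den (MvPolynomial (Fin (m + 2)) ℂ) φ :
            MvPolynomial (Fin (m + 2)) ℂ) ∣
          MvPolynomial.X 0 ^ a * MvPolynomial.X (Fin.last (m + 1)) ^ b) ∧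
        ∀ p : MvPolynomial (Fin (m + 2)) ℂ, Irreducible p → p ∣ (GKZ.genericPoly k).discr →
          ¬ Associated p (MvPolynomial.X 0) →
          ¬ Associated p (MvPolynomial.X (Fin.last (m + 1))) →
          ¬ p ∣ (IsFractionRing.den (MvPolynomial (Fin (m + 2)) ℂ) φ :
            MvPolynomial (Fin (m + 2)) ℂ)) ∧
    -- for a non-integral exponent there is only the zero solution
    (∀ α : Fin 2 → ℂ, (¬ ∃ a : Fin 2 → ℤ, α = fun i => (a i : ℂ)) →
      ∀ φ : GKZ.RatFun (m + 2),
        GKZ.IsRationalSolution (GKZ.curveMatrix k) α φ ↔ φ = 0) ∧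
    -- for `α ∈ A · ℕ^(m+2)`: exactly the multiples of the hypergeometric polynomial
    (∀ α : Fin 2 → ℤ, α ∈ GKZ.expSemigroup (GKZ.curveMatrix k) →
      ∀ φ : GKZ.RatFun (m + 2),
        GKZ.IsRationalSolution (GKZ.curveMatrix k) (fun i => (α i : ℂ)) φ ↔
          ∃ c : ℂ, φ = c • GKZ.ofPoly (GKZ.hypPoly (GKZ.curveMatrix k) α)) ∧
    -- for `α ∉ A · ℕ^(m+2)`: exactly the combinations of the two Laurent polynomials
    (∀ α : Fin 2 → ℤ, α ∉ GKZ.expSemigroup (GKZ.curveMatrix k) →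
      ∀ φ : GKZ.RatFun (m + 2),
        GKZ.IsRationalSolution (GKZ.curveMatrix k) (fun i => (α i : ℂ)) φ ↔
          ∃ c₀ c_d : ℂ, φ = c₀ • GKZ.psiZero (GKZ.curveMatrix k) α +
            c_d • GKZ.psiLast (GKZ.curveMatrix k) α) := by
  obtain ⟨hlaurent, hclass⟩ := theorem1p10_general m hm k hk
  exact ⟨fun α φ h => ⟨(hlaurent α φ h).1, (hlaurent α φ h).2.1, fun p hp _ h0 hlast hden =>
    ((hlaurent α φ h).2.2 p hp hden).elim h0 hlast⟩, hclass⟩
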